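/- Let \(I=(0,1)\), let \(\|\cdot\|\) and \((\cdot,\cdot)\) be the norm and inner product of \(L_2(I)\), and let \(\mathcal T=\{I_j=(x_{j-1},x_j):j=1,\dots,n\}\) be the mesh given by nodes \(0=x_0<x_1<\dots<x_n=1\), \(h_j=x_j-x_{j-1}\). Let \(H^2(\mathcal T)=\{v\in L_2(I): v|_{I_j}\in H^2(I_j)\ \forall j\}\), \(V=H^2(\mathcal T)\times H^2(\mathcal T)\) with inner product \(\langle (z,W),(\delta z,\delta W)\rangle_V=(z,\delta z)+(z'',\delta z'')_{\mathcal T}+(W,\delta W)+(W'',\delta W'')_{\mathcal T}\), where \((\cdot,\cdot)_{\mathcal T}\) is the \(L_2\) inner product with derivatives taken piecewise on \(\mathcal T\). For \(t\in[0,1]\) and \(a\in\{cc,cs,cf,ss\}\) (clamped-clamped, clamped-supported, clamped-free, supported-supported) let \(\mathbb H^2_a(t)\) be the set of \((u,M)\in H^2(I)\times H^2(I)\) with \[ \begin{array}{ll} cc: & u(0)=u'(0)-t^2M'(0)=u(1)=u'(1)-t^2M'(1)=0,\\ cs: & u(0)=u'(0)-t^2M'(0)=u(1)=M(1)=0,\\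 cf: & u(0)=u'(0)-t^2M'(0)=M(1)=M'(1)=0,\\ ss: & u(0)=M(0)=u(1)=M(1)=0. \end{array} \] Let \(\gamma_h(v)=\bigl(v(x_{j-1}),v'(x_{j-1}),v(x_j),v'(x_j)\bigr)_{j=1}^n\) (taken element-wise), \(\gamma_h(u,M)=(\gamma_h(u),\gamma_h(M))\), \(\hat U_a(t)=\gamma_h(\mathbb H^2_a(t))\) and \(U_a(t)=L_2(I)\times L_2(I)\times\hat U_a(t)\). For \(\hat q=\gamma_h(u,M)\) and \((z,W)\in V\) put \[ \langle\hat q,(z,W)\rangle_t=\sum_{j=1}^n\Bigl(-[uW']_j+[M'z]_j-[M(z'-t^2W')]_j+[(u'-t^2M')W]_j\Bigr), \] where \([g]_j=g(x_j)-g(x_{j-1})\) with the values taken from within \(I_j\), and \[ b_t((u,M,\hat q),(z,W))=(u,W'')_{\mathcal T}+(M,W+z''-t^2W'')_{\mathcal T}+\langle\hat q,(z,W)\rangle_t . \] Let \(\|\hat q\|_h^2=\sum_{j=1}^n\bigl(\|\gamma_j(u)\|_j^2+\|\gamma_j(M)\|_j^2\bigr)\) for \(\hat q=\gamma_h(u,M)\),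 where \(\gamma_j(v)\) is the \(j\)-th entry of \(\gamma_h(v)\) and, with \((v_0,d_0,v_1,d_1)=\gamma_j(v)\) and \(h=h_j\), \[ \begin{aligned} \|\gamma_j(v)\|_j^2={}&\tfrac{h}{420}\bigl[156(v_0^2+v_1^2)+4h^2(d_0^2+d_1^2)+108v_0v_1+44h(v_0d_0-v_1d_1)-6h^2d_0d_1+26h(v_1d_0-v_0d_1)\bigr]\\ &+\tfrac{2}{h^3}\bigl[6(v_0-v_1)^2+2h^2(d_0^2+d_0d_1+d_1^2)+6h(v_0d_0-v_1d_1+v_0d_1-v_1d_0)\bigr]. \end{aligned} \] **Theorem.** For every \(a\in\{cc,cs,cf,ss\}\) there is a constant \(C>0\) such that the following holds for all \(t\in[0,1]\) (including the Euler–Bernoulli limit \(t=0\)), all \(f\in L_2(I)\) and all meshes \(\mathcal T\). There is a unique \((u,M,\hat q)\in U_a(t)\) with \(b_t((u,M,\hat q),(z,W))=-(f,z)\) for all \((z,W)\in V\). Let \(U_{a,h}(t)\subset U_a(t)\) be any finite-dimensional subspace, and let \(T_t:U_a(t)\to V\) be the trial-to-test operator defined by \(\langle T_t x,v\rangle_V=b_t(x,v)\)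 for all \(v\in V\). Then there is a unique \((u_h,M_h,\hat q_h)\in U_{a,h}(t)\) with \(b_t((u_h,M_h,\hat q_h),T_t\delta)=-(f,z_\delta)\) for all \(\delta\in U_{a,h}(t)\), where \(T_t\delta=(z_\delta,W_\delta)\), and \[ \|u-u_h\|+\|M-M_h\|+\|\hat q-\hat q_h\|_h\le C\inf\bigl\{\|u-v_h\|+\|M-Q_h\|+\|\hat q-\hat r_h\|_h:\ (v_h,Q_h,\hat r_h)\in U_{a,h}(t)\bigr\}. \] If moreover the finite-dimensional trace space is not discretized, i.e. \(\{0\}\times\{0\}\times\hat U_a(t)\subset U_{a,h}(t)\), then \[ \|u-u_h\|+\|M-M_h\|+\|\hat q-\hat q_h\|_h\le C\inf\bigl\{\|u-v_h\|+\|M-Q_h\|:\ (v_h,Q_h,\hat r_h)\in U_{a,h}(t)\bigr\}. \] The constant \(C\) is independent of \(f\), \(\mathcal T\), \(U_{a,h}(t)\) and \(t\). -/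

import Mathlib

open MeasureTheory Set
open scoped ContDiff

noncomputable section

namespace Beam

/-- `w` is the weak derivative of `v` on the open interval `(a, b)`. -/
def HasWeakDeriv (a b : ℝ) (v w : ℝ → ℝ) : Prop :=
  ∀ φ : ℝ → ℝ, ContDiff ℝ ∞ φ → HasCompactSupport φ → tsupport φ ⊆ Ioo a b →
    ∫ x in a..b, v x * deriv φ x = -∫ x in a..b, w x * φ x

/-- An element of the Sobolev space `H²(a, b)`, given by the representatives of `v` and of its weak
derivative `v'` that are continuous on `[a, b]` (they exist and are unique for every element of
`H²(a, b)`, and are the ones used in point evaluations), and by a representative of the weak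
second derivative `v'' ∈ L₂(a, b)`. Values outside `[a, b]` are irrelevant. -/
structure H2 (a b : ℝ) where
  val : ℝ → ℝ
  d1 : ℝ → ℝ
  d2 : ℝ → ℝ
  continuousOn_val : ContinuousOn val (Icc a b)
  continuousOn_d1 : ContinuousOn d1 (Icc a b)
  memLp_d2 : MemLp d2 2 (volume.restrict (Ioo a b))
  weakDeriv_val : HasWeakDeriv a b val d1
  weakDeriv_d1 : HasWeakDeriv a b d1 d2

/-- The space `L₂(I)`, `I = (0, 1)`. -/
abbrev L2I : Type := Lp ℝ 2 (volume.restrict (Ioo (0 : ℝ) 1))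

/-- A partition `0 = x₀ < x₁ < ⋯ < xₙ = 1` of `I`. -/
structure Mesh (n : ℕ) where
  node : Fin (n + 1) → ℝ
  strictMono_node : StrictMono node
  node_zero : node 0 = 0
  node_last : node (Fin.last n) = 1

variable {n : ℕ}

/-- Left end of the `j`-th element. -/
def Mesh.left (𝒯 : Mesh n) (j : Fin n) : ℝ := 𝒯.node j.castSucc

/-- Right end of the `j`-th element. -/
def Mesh.right (𝒯 : Mesh n) (j : Fin n) : ℝ := 𝒯.node j.succ

/-- Length of the `j`-th element. -/
def Mesh.h (𝒯 : Mesh n) (j : Fin n) : ℝ := 𝒯.right j - 𝒯.left j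

/-- The broken space `H²(𝒯)`, an element being the family of its restrictions to the mesh
elements. -/
abbrev BrokenH2 (𝒯 : Mesh n) : Type := (j : Fin n) → H2 (𝒯.left j) (𝒯.right j)

/-- The test space `V = H²(𝒯) × H²(𝒯)`. -/
abbrev TestSpace (𝒯 : Mesh n) : Type := BrokenH2 𝒯 × BrokenH2 𝒯

/-- Element-wise boundary data: for each element the four numbers
`(v(x_{j-1}), v'(x_{j-1}), v(x_j), v'(x_j))`. -/
abbrev TraceData (n : ℕ) : Type := Fin n → Fin 4 → ℝ

/-- The trace map `γ_h` on the broken space `H²(𝒯)`. -/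
def brokenTrace (𝒯 : Mesh n) (z : BrokenH2 𝒯) : TraceData n := fun j =>
  ![(z j).val (𝒯.left j), (z j).d1 (𝒯.left j), (z j).val (𝒯.right j), (z j).d1 (𝒯.right j)]

/-- The trace map `γ_h` on `H²(I)`. -/
def trace (𝒯 : Mesh n) (v : H2 0 1) : TraceData n := fun j =>
  ![v.val (𝒯.left j), v.d1 (𝒯.left j), v.val (𝒯.right j), v.d1 (𝒯.right j)]

/-- Boundary conditions: clamped-clamped, clamped-supported, clamped-free,
supported-supported. -/
inductive BC : Type
  | cc
  | cs
  | cf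
  | ss

/-- The pair `(u, M) ∈ H²(I) × H²(I)` satisfies the boundary conditions of type `a` for the
thickness `t`, i.e. `(u, M) ∈ ℍ²ₐ(t)`. -/
def SatisfiesBC : BC → ℝ → H2 0 1 → H2 0 1 → Prop
  | .cc, t, u, M =>
      u.val 0 = 0 ∧ u.d1 0 - t ^ 2 * M.d1 0 = 0 ∧ u.val 1 = 0 ∧ u.d1 1 - t ^ 2 * M.d1 1 = 0
  | .cs, t, u, M =>
      u.val 0 = 0 ∧ u.d1 0 - t ^ 2 * M.d1 0 = 0 ∧ u.val 1 = 0 ∧ M.val 1 = 0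
  | .cf, t, u, M =>
      u.val 0 = 0 ∧ u.d1 0 - t ^ 2 * M.d1 0 = 0 ∧ M.val 1 = 0 ∧ M.d1 1 = 0
  | .ss, _, u, M =>
      u.val 0 = 0 ∧ M.val 0 = 0 ∧ u.val 1 = 0 ∧ M.val 1 = 0

/-- The trace space `Ûₐ(t) = γ_h(ℍ²ₐ(t))`. -/
def traceSpace (𝒯 : Mesh n) (a : BC) (t : ℝ) : Set (TraceData n × TraceData n) :=
  {q | ∃ u M : H2 0 1, SatisfiesBC a t u M ∧ q = (trace 𝒯 u, trace 𝒯 M)}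

/-- The ambient vector space of the triples `(u, M, q̂)`. -/
abbrev Triple (n : ℕ) : Type := L2I × L2I × (TraceData n × TraceData n)

/-- The trial space `Uₐ(t) = L₂(I) × L₂(I) × Ûₐ(t)`. -/
def trialSpace (𝒯 : Mesh n) (a : BC) (t : ℝ) : Set (Triple n) :=
  {x | x.2.2 ∈ traceSpace 𝒯 a t}

/-- The duality `⟨q̂, (z, W)⟩_t`. With `q̂ = γ_h(u, M)` the four groups are the boundary terms
`-[u W']_j`, `[M' z]_j`, `-[M (z' - t² W')]_j` and `[(u' - t² M') W]_j`, where `[·]_j` is the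
value at the right end minus the value at the left end. -/
def pairing (𝒯 : Mesh n) (t : ℝ) (q : TraceData n × TraceData n) (v : TestSpace 𝒯) : ℝ :=
  let u := q.1
  let M := q.2
  let z := brokenTrace 𝒯 v.1
  let W := brokenTrace 𝒯 v.2
  ∑ j : Fin n,
    (-(u j 2 * W j 3 - u j 0 * W j 1)
      + (M j 3 * z j 2 - M j 1 * z j 0)
      - (M j 2 * (z j 3 - t ^ 2 * W j 3) - M j 0 * (z j 1 - t ^ 2 * W j 1))
      + ((u j 3 - t ^ 2 * M j 3) * W j 2 - (u j 1 - t ^ 2 * M j 1) * W j 0))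

/-- The squared discrete norm of element-wise boundary data on an element of length `h`, with
`p = (v(x_{j-1}), v'(x_{j-1}), v(x_j), v'(x_j))`. -/
def elemNormSq (h : ℝ) (p : Fin 4 → ℝ) : ℝ :=
  let v₀ := p 0
  let d₀ := p 1
  let v₁ := p 2
  let d₁ := p 3
  h / 420 *
    (156 * (v₀ ^ 2 + v₁ ^ 2) + 4 * h ^ 2 * (d₀ ^ 2 + d₁ ^ 2)
      + 108 * v₀ * v₁ + 44 * h * (v₀ * d₀ - v₁ * d₁)
      - 6 * h ^ 2 * d₀ * d₁ + 26 * h * (v₁ * d₀ - v₀ * d₁))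
  + 2 / h ^ 3 *
    (6 * (v₀ ^ 2 - 2 * v₀ * v₁ + v₁ ^ 2)
      + 2 * h ^ 2 * (d₀ ^ 2 + d₀ * d₁ + d₁ ^ 2)
      + 6 * h * (v₀ * d₀ - v₁ * d₁ + v₀ * d₁ - v₁ * d₀))

/-- The discrete trace norm `‖q̂‖_h`. -/
def traceNorm (𝒯 : Mesh n) (q : TraceData n × TraceData n) : ℝ :=
  Real.sqrt (∑ j : Fin n, (elemNormSq (𝒯.h j) (q.1 j) + elemNormSq (𝒯.h j) (q.2 j)))

/-- The inner product of the test space `V`. -/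
def testInner (𝒯 : Mesh n) (v w : TestSpace 𝒯) : ℝ :=
  ∑ j : Fin n,
    ((∫ x in 𝒯.left j..𝒯.right j, (v.1 j).val x * (w.1 j).val x)
      + (∫ x in 𝒯.left j..𝒯.right j, (v.1 j).d2 x * (w.1 j).d2 x)
      + (∫ x in 𝒯.left j..𝒯.right j, (v.2 j).val x * (w.2 j).val x)
      + (∫ x in 𝒯.left j..𝒯.right j, (v.2 j).d2 x * (w.2 j).d2 x))

/-- The bilinear form
`b_t((u, M, q̂), (z, W)) = (u, W'')_𝒯 + (M, W + z'' - t² W'')_𝒯 + ⟨q̂, (z, W)⟩_t`. -/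
def bForm (𝒯 : Mesh n) (t : ℝ) (x : Triple n) (v : TestSpace 𝒯) : ℝ :=
  (∑ j : Fin n, ∫ s in 𝒯.left j..𝒯.right j, x.1 s * (v.2 j).d2 s)
  + (∑ j : Fin n, ∫ s in 𝒯.left j..𝒯.right j,
      x.2.1 s * ((v.2 j).val s + (v.1 j).d2 s - t ^ 2 * (v.2 j).d2 s))
  + pairing 𝒯 t x.2.2 v

/-- The functional `L_f(z, W) = -(f, z)`. -/
def load (𝒯 : Mesh n) (f : L2I) (v : TestSpace 𝒯) : ℝ :=
  -∑ j : Fin n, ∫ s in 𝒯.left j..𝒯.right j, f s * (v.1 j).val s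

/-- `x = (u, M, q̂)` solves the ultraweak variational formulation. -/
def IsSolution (𝒯 : Mesh n) (a : BC) (t : ℝ) (f : L2I) (x : Triple n) : Prop :=
  x ∈ trialSpace 𝒯 a t ∧ ∀ v : TestSpace 𝒯, bForm 𝒯 t x v = load 𝒯 f v

/-- `T` is (on `Uₐ(t)`) the trial-to-test operator `T_t`. -/
def IsTrialToTest (𝒯 : Mesh n) (a : BC) (t : ℝ) (T : Triple n → TestSpace 𝒯) : Prop :=
  ∀ x ∈ trialSpace 𝒯 a t, ∀ v : TestSpace 𝒯, testInner 𝒯 (T x) v = bForm 𝒯 t x v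

/-- `y = (u_h, M_h, q̂_h)` solves the DPG scheme with discrete space `Uh`. -/
def IsDPGSolution (𝒯 : Mesh n) (a : BC) (t : ℝ) (f : L2I) (Uh : Submodule ℝ (Triple n))
    (y : Triple n) : Prop :=
  y ∈ Uh ∧ ∃ T : Triple n → TestSpace 𝒯, IsTrialToTest 𝒯 a t T ∧
    ∀ δ ∈ Uh, bForm 𝒯 t y (T δ) = load 𝒯 f (T δ)

/-- The error `‖u - u_h‖ + ‖M - M_h‖ + ‖q̂ - q̂_h‖_h`. -/
def fullError (𝒯 : Mesh n) (x y : Triple n) : ℝ :=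
  ‖x.1 - y.1‖ + ‖x.2.1 - y.2.1‖ + traceNorm 𝒯 (x.2.2 - y.2.2)

/-- The `L₂`-error `‖u - v_h‖ + ‖M - Q_h‖`. -/
def l2Error (x y : Triple n) : ℝ :=
  ‖x.1 - y.1‖ + ‖x.2.1 - y.2.1‖

end Beam

end

/-! The scheme is an orthogonal projection in disguise. The map `embed`, (z, W) ↦ (z, z'', W, W''),
is isometric from the test space into four copies of L₂(I), and `embed` after the trial-to-test
operator is a linear map A with (A x, embed v) = b_t(x, v). The DPG equations say that A(x - y) is
orthogonal to the image of the discrete space under A, so y is a best approximation of x in the norm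
‖A ·‖. Quasi-optimality thus follows from an equivalence between ‖A x‖ and the trial norm ‖u‖ + ‖M‖
+ ‖q̂‖_h, with constants independent of mesh and t.

Upper bound (`exists_bForm_eq_inner`): the explicit trace norm is the H² graph norm of the cubic
Hermite interpolant. Lifting q̂ by Hermite interpolation and applying Green's formula on each
element turns b_t(x, ·) into an L₂ inner product with a vector controlled by the trial norm.

Lower bound (`trialNorm_le_norm_embed`): let (R₁, R₂) be the Riesz representative of b_t(x, ·).
Testing with z and W separately shows that m = M - R₁'' and p = u - t²M - R₂'' are H² functions on
all of I with m'' = R₁, p'' + m = R₂ - R₁'', and traces M̂ and û - t²M̂. Hence p + t²m and m inherit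
the boundary conditions. Green's formula for p and m has boundary terms t²[m m'], which produce
t²‖m'‖² with the favourable sign; this term is dropped, and the estimate holds uniformly down to t =
0 (`SatisfiesBC.norm_le`). The bounds on u, M and q̂ follow.

A solution exists because in the unknowns m = M, p = u - t²M the problem is m'' = -f, p'' = -m:
integrate twice and correct the boundary values by a homogeneous solution. When all traces are
discrete, a competitor can be given the exact trace, so the trace term disappears from the infimum.
-/

open MeasureTheory Set
open scoped ContDiff

noncomputable section

namespace Beam

/-! ### Weak derivatives and primitives on an interval -/

section
/-- `v` is on `[a, b]` a primitive of the integrable function `w`. -/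
structure IsPrimitive (a b : ℝ) (v w : ℝ → ℝ) : Prop where
  intervalIntegrable : IntervalIntegrable w volume a b
  eq_add_integral : ∀ x ∈ Icc a b, v x = v a + ∫ s in a..x, w s

theorem intervalIntegrable_mono_of_le {f : ℝ → ℝ} {a b c d : ℝ}
    (h : IntervalIntegrable f volume a b) (hac : a ≤ c) (hcd : c ≤ d) (hdb : d ≤ b) :
    IntervalIntegrable f volume c d := by
  apply h.mono_set
  rw [uIcc_of_le hcd, uIcc_of_le (hac.trans (hcd.trans hdb))]
  exact Icc_subset_Icc hac hdb

namespace IsPrimitive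

variable {a b : ℝ} {v w v₁ w₁ : ℝ → ℝ}

theorem continuousOn (h : IsPrimitive a b v w) (hab : a ≤ b) : ContinuousOn v (Icc a b) := by
  have h1 : ContinuousOn (fun x => v a + ∫ s in a..x, w s) (Icc a b) := by
    have := intervalIntegral.continuousOn_primitive_interval (a := a) (b := b)
      (μ := volume) (f := w) ?_
    · rw [uIcc_of_le hab] at this
      exact continuousOn_const.add this
    · rw [uIcc_of_le hab]
      exact (intervalIntegrable_iff_integrableOn_Icc_of_le hab).1 h.intervalIntegrable
  exact h1.congr h.eq_add_integral

theorem sub_eq (h : IsPrimitive a b v w) {x y : ℝ} (hx : a ≤ x) (hxy : x ≤ y) (hy : y ≤ b) :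
    v y - v x = ∫ s in x..y, w s := by
  rw [h.eq_add_integral y ⟨hx.trans hxy, hy⟩, h.eq_add_integral x ⟨hx, hxy.trans hy⟩]
  rw [add_sub_add_left_eq_sub, intervalIntegral.integral_interval_sub_left]
  · exact intervalIntegrable_mono_of_le h.intervalIntegrable le_rfl (hx.trans hxy) hy
  · exact intervalIntegrable_mono_of_le h.intervalIntegrable le_rfl hx (hxy.trans hy)

theorem mono (h : IsPrimitive a b v w) {c d : ℝ} (hac : a ≤ c) (hcd : c ≤ d) (hdb : d ≤ b) :
    IsPrimitive c d v w :=
  ⟨intervalIntegrable_mono_of_le h.intervalIntegrable hac hcd hdb, fun x hx => by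
    rw [← h.sub_eq hac hx.1 (hx.2.trans hdb)]; ring⟩

theorem add (h : IsPrimitive a b v w) (h₁ : IsPrimitive a b v₁ w₁) :
    IsPrimitive a b (fun x => v x + v₁ x) (fun x => w x + w₁ x) :=
  ⟨h.intervalIntegrable.add h₁.intervalIntegrable, fun x hx => by
    rw [intervalIntegral.integral_add, h.eq_add_integral x hx, h₁.eq_add_integral x hx]
    · ring
    · exact intervalIntegrable_mono_of_le h.intervalIntegrable le_rfl hx.1 hx.2
    · exact intervalIntegrable_mono_of_le h₁.intervalIntegrable le_rfl hx.1 hx.2⟩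

theorem const_mul (h : IsPrimitive a b v w) (c : ℝ) :
    IsPrimitive a b (fun x => c * v x) (fun x => c * w x) :=
  ⟨h.intervalIntegrable.const_mul c, fun x hx => by
    rw [intervalIntegral.integral_const_mul, h.eq_add_integral x hx]; ring⟩

theorem of_hasDerivAt (hd : ∀ x, HasDerivAt v (w x) x) (hw : Continuous w) :
    IsPrimitive a b v w :=
  ⟨hw.intervalIntegrable _ _, fun x _ => by
    rw [intervalIntegral.integral_eq_sub_of_hasDerivAt (fun x _ => hd x)
      (hw.intervalIntegrable _ _)]
    ring⟩

theorem integral (c : ℝ) (hw : IntervalIntegrable w volume a b) :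
    IsPrimitive a b (fun x => c + ∫ s in a..x, w s) w :=
  ⟨hw, fun x _ => by simp⟩

/-- Integration by parts for primitives. -/
theorem integral_mul_add (h : IsPrimitive a b v w) (h₁ : IsPrimitive a b v₁ w₁) (hab : a ≤ b) :
    ∫ x in a..b, (w x * v₁ x + v x * w₁ x) = v b * v₁ b - v a * v₁ a := by
  -- Nothing is known about `f` outside [a, b], so absolute continuity and the derivative are stated
  -- for the primitive f(a) + ∫ g, which agrees with `f` on [a, b].
  have key : ∀ {f g : ℝ → ℝ}, IsPrimitive a b f g →
      AbsolutelyContinuousOnInterval (fun x => f a + ∫ s in a..x, g s) a b ∧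
      ∀ᵐ x, x ∈ uIoc a b → deriv (fun x => f a + ∫ s in a..x, g s) x = g x := by
    intro f g hfg
    constructor
    · have h1 := hfg.intervalIntegrable.absolutelyContinuousOnInterval_intervalIntegral
        (c := a) (by simp)
      have h2 : AbsolutelyContinuousOnInterval (fun _ : ℝ => f a) a b :=
        contDiffOn_const.absolutelyContinuousOnInterval
      exact h2.add h1
    · filter_upwards [hfg.intervalIntegrable.ae_hasDerivAt_integral] with x hx hx'
      exact ((hx (uIoc_subset_uIcc hx') a (by simp)).const_add (f a)).deriv
  obtain ⟨hA, hA'⟩ := key h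
  obtain ⟨hB, hB'⟩ := key h₁
  have := hA.integral_deriv_mul_eq_sub hB
  rw [h.eq_add_integral b ⟨hab, le_rfl⟩, h₁.eq_add_integral b ⟨hab, le_rfl⟩]
  simp only [intervalIntegral.integral_same, add_zero] at this
  rw [← this]
  apply intervalIntegral.integral_congr_ae
  filter_upwards [hA', hB'] with x hx hx' hm
  have hmI : x ∈ Icc a b := by
    rw [uIoc_of_le hab] at hm
    exact ⟨hm.1.le, hm.2⟩
  rw [hx hm, hx' hm, h.eq_add_integral x hmI, h₁.eq_add_integral x hmI]

theorem integral_mul_eq (h : IsPrimitive a b v w) (h₁ : IsPrimitive a b v₁ w₁) (hab : a ≤ b) :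
    ∫ x in a..b, w x * v₁ x = v b * v₁ b - v a * v₁ a - ∫ x in a..b, v x * w₁ x := by
  rw [← h.integral_mul_add h₁ hab, intervalIntegral.integral_add]
  · ring
  · apply h.intervalIntegrable.mul_continuousOn
    rw [uIcc_of_le hab]; exact h₁.continuousOn hab
  · apply h₁.intervalIntegrable.continuousOn_mul
    rw [uIcc_of_le hab]; exact h.continuousOn hab

theorem hasWeakDeriv (h : IsPrimitive a b v w) (hab : a ≤ b) : HasWeakDeriv a b v w := by
  intro φ hφ _ hs
  have h1 : IsPrimitive a b φ (deriv φ) :=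
    of_hasDerivAt (fun x => (hφ.differentiable (by simp) x).hasDerivAt)
      (hφ.continuous_deriv (by simp))
  have ha : φ a = 0 := image_eq_zero_of_notMem_tsupport fun h => lt_irrefl _ (hs h).1
  have hb : φ b = 0 := image_eq_zero_of_notMem_tsupport fun h => lt_irrefl _ (hs h).2
  rw [h.integral_mul_eq h1 hab, ha, hb]
  ring

end IsPrimitive

theorem exists_Icc_of_isCompact_subset_Ioo {a b : ℝ} (hab : a < b) {K : Set ℝ} (hK : IsCompact K)
    (hs : K ⊆ Ioo a b) : ∃ c d, a < c ∧ d < b ∧ K ⊆ Icc c d := by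
  rcases K.eq_empty_or_nonempty with rfl | hne
  · obtain ⟨c, hc⟩ := exists_between hab
    exact ⟨c, c, hc.1, hc.2, by simp⟩
  · obtain ⟨c, hc, hc'⟩ := hK.exists_isLeast hne
    obtain ⟨d, hd, hd'⟩ := hK.exists_isGreatest hne
    exact ⟨c, d, (hs hc).1, (hs hd).2, fun x hx => ⟨hc' hx, hd' hx⟩⟩

/-- A test function of zero mean is the derivative of a test function. -/
theorem exists_test_primitive {a b : ℝ} (hab : a < b) {χ : ℝ → ℝ} (hχ : ContDiff ℝ ∞ χ)
    (hc : HasCompactSupport χ) (hs : tsupport χ ⊆ Ioo a b) (h0 : ∫ x in a..b, χ x = 0) :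
    ∃ φ : ℝ → ℝ, ContDiff ℝ ∞ φ ∧ HasCompactSupport φ ∧ tsupport φ ⊆ Ioo a b ∧ deriv φ = χ := by
  obtain ⟨c, d, hac, hdb, hK⟩ := exists_Icc_of_isCompact_subset_Ioo hab hc hs
  -- Left of the support of `χ` the primitive is trivially zero; right of it, it equals the whole
  -- integral, which vanishes by assumption.
  have hsupp : Function.support (fun x => ∫ s in a..x, χ s) ⊆ Icc c d := by
    intro x hx
    by_contra hcon
    apply hx
    by_cases hxc : x < c
    · have : ∀ y ∈ uIcc a x, χ y = 0 := by
        intro y hy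
        apply image_eq_zero_of_notMem_tsupport
        intro hy'
        have h1 := (hK hy').1
        have h2 : y ≤ max a x := hy.2
        rcases le_max_iff.1 h2 with h | h <;> linarith
      change ∫ s in a..x, χ s = 0
      rw [intervalIntegral.integral_congr this]
      simp
    · have hdx : d < x := by
        by_contra h
        exact hcon ⟨not_lt.1 hxc, not_lt.1 h⟩
      have e1 : ∫ s in a..x, χ s = ∫ s, χ s :=
        intervalIntegral.integral_eq_integral_of_support_subset fun y hy =>
          have := hK (subset_tsupport _ hy)
          ⟨hac.trans_le this.1, this.2.trans hdx.le⟩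
      have e2 : ∫ s in a..b, χ s = ∫ s, χ s :=
        intervalIntegral.integral_eq_integral_of_support_subset fun y hy =>
          have := hK (subset_tsupport _ hy)
          ⟨hac.trans_le this.1, this.2.trans hdb.le⟩
      change ∫ s in a..x, χ s = 0
      rw [e1, ← e2, h0]
  have hts : tsupport (fun x => ∫ s in a..x, χ s) ⊆ Icc c d :=
    closure_minimal hsupp isClosed_Icc
  have hder : deriv (fun x => ∫ s in a..x, χ s) = χ := by
    funext x
    exact hχ.continuous.deriv_integral χ a x
  refine ⟨fun x => ∫ s in a..x, χ s, ?_, ?_, ?_, hder⟩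
  · rw [contDiff_infty_iff_deriv, hder]
    exact ⟨fun x => (hχ.continuous.integral_hasStrictDerivAt a x).hasDerivAt.differentiableAt, hχ⟩
  · exact HasCompactSupport.of_support_subset_isCompact isCompact_Icc hsupp
  · exact fun x hx => ⟨hac.trans_le (hts hx).1, (hts hx).2.trans_lt hdb⟩

theorem exists_test_integral_eq_one {a b : ℝ} (hab : a < b) :
    ∃ ψ : ℝ → ℝ, ContDiff ℝ ∞ ψ ∧ HasCompactSupport ψ ∧ tsupport ψ ⊆ Ioo a b ∧
      ∫ x in a..b, ψ x = 1 := by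
  let f : ContDiffBump ((a + b) / 2) := ⟨(b - a) / 8, (b - a) / 4, by linarith, by linarith⟩
  have hs : tsupport (f.normed volume) ⊆ Ioo a b := by
    rw [f.tsupport_normed_eq, Real.closedBall_eq_Icc]
    intro x hx
    simp only [f, mem_Icc] at hx
    exact ⟨by linarith [hx.1], by linarith [hx.2]⟩
  refine ⟨f.normed volume, f.contDiff_normed, f.hasCompactSupport_normed, hs, ?_⟩
  rw [intervalIntegral.integral_eq_integral_of_support_subset]
  · exact f.integral_normed
  · exact ((subset_tsupport _).trans hs).trans Ioo_subset_Ioc_self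

/-- The lemma of du Bois-Reymond for continuous functions. -/
theorem eq_const_of_integral_mul_deriv_eq_zero {a b : ℝ} (hab : a < b) {g : ℝ → ℝ}
    (hg : ContinuousOn g (Icc a b))
    (h : ∀ φ : ℝ → ℝ, ContDiff ℝ ∞ φ → HasCompactSupport φ → tsupport φ ⊆ Ioo a b →
      ∫ x in a..b, g x * deriv φ x = 0) : ∃ c, ∀ x ∈ Icc a b, g x = c := by
  obtain ⟨ψ, hψ, hψc, hψs, hψ1⟩ := exists_test_integral_eq_one hab
  have hgu : ContinuousOn g (uIcc a b) := by rwa [uIcc_of_le hab.le]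
  have hint : ∀ η : ℝ → ℝ, Continuous η → IntervalIntegrable (fun x => g x * η x) volume a b :=
    fun η hη => (hgu.mul hη.continuousOn).intervalIntegrable
  refine ⟨∫ x in a..b, g x * ψ x, ?_⟩
  have hae : ∀ᵐ x, x ∈ Ioo a b → g x - (∫ x in a..b, g x * ψ x) = 0 := by
    refine isOpen_Ioo.ae_eq_zero_of_integral_contDiff_smul_eq_zero (μ := volume)
      (f := fun x => g x - (∫ x in a..b, g x * ψ x)) ?_ ?_
    · exact ((hg.mono Ioo_subset_Icc_self).sub continuousOn_const).locallyIntegrableOn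
        measurableSet_Ioo
    · intro η hη hηc hηs
      set I := ∫ x in a..b, η x with hI
      -- Subtracting I ψ from `η` removes the mean, so the difference is the derivative of a test
      -- function; this identifies the constant as ∫ g ψ.
      obtain ⟨φ, h1, h2, h3, h4⟩ := exists_test_primitive hab (χ := fun x => η x - I * ψ x)
        (hη.sub (contDiff_const.mul hψ)) (hηc.sub (hψc.mul_left))
        (by
          refine (tsupport_sub η _).trans (union_subset hηs ?_)
          exact (tsupport_mul_subset_right).trans hψs)
        (by
          rw [intervalIntegral.integral_sub, intervalIntegral.integral_const_mul, hψ1, ← hI]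
          · ring
          · exact hη.continuous.intervalIntegrable _ _
          · exact (hψ.continuous.const_mul I).intervalIntegrable _ _)
      have := h φ h1 h2 h3
      rw [h4] at this
      have e : ∫ x, η x • (g x - ∫ x in a..b, g x * ψ x)
          = ∫ x in a..b, η x * (g x - ∫ x in a..b, g x * ψ x) := by
        refine (intervalIntegral.integral_eq_integral_of_support_subset
          (f := fun x => η x * (g x - ∫ x in a..b, g x * ψ x)) fun x hx => ?_).symm
        exact Ioo_subset_Ioc_self (hηs (subset_tsupport _ (left_ne_zero_of_mul hx)))
      rw [e]
      have e2 : ∀ x, g x * (η x - I * ψ x) = g x * η x - I * (g x * ψ x) := fun x => by ring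
      have e3 : ∀ J x, η x * (g x - J) = g x * η x - J * η x := fun J x => by ring
      simp_rw [e2] at this
      simp_rw [e3]
      rw [intervalIntegral.integral_sub (hint _ hη.continuous)
        ((hint _ hψ.continuous).const_mul I), intervalIntegral.integral_const_mul] at this
      rw [intervalIntegral.integral_sub (hint _ hη.continuous)
        ((hη.continuous.intervalIntegrable _ _).const_mul _),
        intervalIntegral.integral_const_mul, ← hI]
      linarith
  have h2 : g =ᵐ[volume.restrict (Icc a b)] fun _ => ∫ x in a..b, g x * ψ x := by
    rw [← restrict_Ioo_eq_restrict_Icc]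
    refine (ae_restrict_iff' measurableSet_Ioo).2 ?_
    filter_upwards [hae] with x hx hx'
    linarith [hx hx']
  exact fun x hx => Measure.eqOn_Icc_of_ae_eq volume hab.ne h2 hg continuousOn_const hx

/-- The difference of `v` and a primitive of `w` is continuous with zero weak derivative, hence
constant by du Bois-Reymond. This makes the point values in `H2` usable for exact integration by
parts. -/
theorem HasWeakDeriv.isPrimitive {a b : ℝ} (hab : a < b) {v w : ℝ → ℝ} (h : HasWeakDeriv a b v w)
    (hv : ContinuousOn v (Icc a b)) (hw : IntervalIntegrable w volume a b) :
    IsPrimitive a b v w := by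
  have hP := IsPrimitive.integral 0 hw
  have hPc := hP.continuousOn hab.le
  have hgu : ContinuousOn v (uIcc a b) := by rwa [uIcc_of_le hab.le]
  have hPu := hPc
  rw [← uIcc_of_le hab.le] at hPu
  obtain ⟨c, hc⟩ := eq_const_of_integral_mul_deriv_eq_zero hab (hv.sub hPc) (by
    intro φ hφ hφc hφs
    have hd := hφ.continuous_deriv (by simp)
    have e : ∀ x, ((v - fun x => 0 + ∫ s in a..x, w s) : ℝ → ℝ) x * deriv φ x
      = v x * deriv φ x - (0 + ∫ s in a..x, w s) * deriv φ x := fun x => sub_mul _ _ _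
    simp_rw [e]
    rw [intervalIntegral.integral_sub]
    · rw [h φ hφ hφc hφs, hP.hasWeakDeriv hab.le φ hφ hφc hφs]
      ring
    · exact (hgu.mul hd.continuousOn).intervalIntegrable
    · exact (hPu.mul hd.continuousOn).intervalIntegrable)
  refine ⟨hw, fun x hx => ?_⟩
  have h1 := hc x hx
  have h2 := hc a ⟨le_rfl, hab.le⟩
  simp only [Pi.sub_apply, intervalIntegral.integral_same, add_zero, sub_zero] at h1 h2
  rw [h2]
  linarith

end

/-! ### Square integrable functions, the space H²(a, b) and Green's formula -/

section
/-- Square integrability on `(a, b)`. -/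
abbrev SqInt (a b : ℝ) (f : ℝ → ℝ) : Prop := MemLp f 2 (volume.restrict (Ioo a b))

theorem intervalIntegral_eq_restrict_Ioo {a b : ℝ} (hab : a ≤ b) (f : ℝ → ℝ) :
    ∫ x in a..b, f x = ∫ x, f x ∂(volume.restrict (Ioo a b)) := by
  rw [intervalIntegral.integral_of_le hab, integral_Ioc_eq_integral_Ioo]

theorem intervalIntegrable_iff_restrict_Ioo {a b : ℝ} (hab : a ≤ b) {f : ℝ → ℝ} :
    IntervalIntegrable f volume a b ↔ Integrable f (volume.restrict (Ioo a b)) := by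
  rw [intervalIntegrable_iff_integrableOn_Ioo_of_le hab]; rfl

theorem intervalIntegral_congr_Ioo {a b : ℝ} (hab : a ≤ b) {f g : ℝ → ℝ}
    (h : f =ᵐ[volume.restrict (Ioo a b)] g) : ∫ x in a..b, f x = ∫ x in a..b, g x := by
  rw [intervalIntegral_eq_restrict_Ioo hab, intervalIntegral_eq_restrict_Ioo hab]
  exact integral_congr_ae h

namespace SqInt

variable {a b : ℝ} {f g : ℝ → ℝ}

theorem intervalIntegrable (hf : SqInt a b f) (hab : a ≤ b) : IntervalIntegrable f volume a b :=
  (intervalIntegrable_iff_restrict_Ioo hab).2 (hf.integrable (by norm_num))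

theorem mul_intervalIntegrable (hf : SqInt a b f) (hg : SqInt a b g) (hab : a ≤ b) :
    IntervalIntegrable (fun x => f x * g x) volume a b :=
  (intervalIntegrable_iff_restrict_Ioo hab).2 (MemLp.integrable_mul hf hg)

theorem of_continuousOn (hf : ContinuousOn f (Icc a b)) : SqInt a b f := by
  have h1 : MemLp f 2 (volume.restrict (Icc a b)) := by
    obtain ⟨C, hC⟩ := isCompact_Icc.exists_bound_of_continuousOn hf
    exact MemLp.of_bound (hf.aestronglyMeasurable measurableSet_Icc) C
      ((ae_restrict_iff' measurableSet_Icc).2 (ae_of_all _ hC))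
  exact h1.mono_measure (Measure.restrict_mono Ioo_subset_Icc_self le_rfl)

theorem mono (hf : SqInt a b f) {c d : ℝ} (hac : a ≤ c) (hdb : d ≤ b) : SqInt c d f :=
  hf.mono_measure (Measure.restrict_mono (Ioo_subset_Ioo hac hdb) le_rfl)

theorem lin (hf : SqInt a b f) (hg : SqInt a b g) (c : ℝ) : SqInt a b (fun x => f x + c * g x) :=
  hf.add (hg.const_mul c)

end SqInt

theorem inner_eq_intervalIntegral {a b : ℝ} (hab : a ≤ b)
    (u v : Lp ℝ 2 (volume.restrict (Ioo a b))) : inner ℝ u v = ∫ x in a..b, u x * v x := by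
  rw [intervalIntegral_eq_restrict_Ioo hab, L2.inner_def]
  simp [mul_comm]

theorem inner_toLp {a b : ℝ} (hab : a ≤ b) {f g : ℝ → ℝ} (hf : SqInt a b f) (hg : SqInt a b g) :
    inner ℝ hf.toLp hg.toLp = ∫ x in a..b, f x * g x := by
  rw [inner_eq_intervalIntegral hab]
  apply intervalIntegral_congr_Ioo hab
  filter_upwards [hf.coeFn_toLp, hg.coeFn_toLp] with x h1 h2
  rw [h1, h2]

theorem inner_toLp_right {a b : ℝ} (hab : a ≤ b) (u : Lp ℝ 2 (volume.restrict (Ioo a b)))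
    {g : ℝ → ℝ} (hg : SqInt a b g) : inner ℝ u hg.toLp = ∫ x in a..b, u x * g x := by
  rw [inner_eq_intervalIntegral hab]
  apply intervalIntegral_congr_Ioo hab
  filter_upwards [hg.coeFn_toLp] with x h2
  rw [h2]

theorem norm_toLp_sq {a b : ℝ} (hab : a ≤ b) {f : ℝ → ℝ} (hf : SqInt a b f) :
    ‖hf.toLp‖ ^ 2 = ∫ x in a..b, f x ^ 2 := by
  rw [← real_inner_self_eq_norm_sq, inner_toLp hab]
  simp_rw [sq]

theorem ae_eq_zero_of_integral_sq {a b : ℝ} (hab : a ≤ b) {f : ℝ → ℝ} (hf : SqInt a b f)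
    (h : ∫ x in a..b, f x ^ 2 = 0) : f =ᵐ[volume.restrict (Ioo a b)] 0 := by
  rw [← norm_toLp_sq hab hf] at h
  exact hf.coeFn_toLp.symm.trans
    (Lp.eq_zero_iff_ae_eq_zero.1 (norm_eq_zero.1 ((pow_eq_zero_iff two_ne_zero).1 h)))

theorem integral_mul_sq_le {a b : ℝ} (hab : a ≤ b) {f g : ℝ → ℝ} (hf : SqInt a b f)
    (hg : SqInt a b g) :
    (∫ x in a..b, f x * g x) ^ 2 ≤ (∫ x in a..b, f x ^ 2) * ∫ x in a..b, g x ^ 2 := by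
  rw [← inner_toLp hab hf hg, ← norm_toLp_sq hab hf, ← norm_toLp_sq hab hg, ← mul_pow]
  exact sq_le_sq.2 ((abs_real_inner_le_norm _ _).trans (le_abs_self _))

namespace H2

variable {a b : ℝ}

theorem isPrimitive_d1 (v : H2 a b) (hab : a < b) : IsPrimitive a b v.d1 v.d2 :=
  v.weakDeriv_d1.isPrimitive hab v.continuousOn_d1 (SqInt.intervalIntegrable v.memLp_d2 hab.le)

theorem isPrimitive_val (v : H2 a b) (hab : a < b) : IsPrimitive a b v.val v.d1 :=
  v.weakDeriv_val.isPrimitive hab v.continuousOn_val (by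
    apply ContinuousOn.intervalIntegrable
    rw [uIcc_of_le hab.le]
    exact v.continuousOn_d1)

theorem sqInt_val (v : H2 a b) : SqInt a b v.val := .of_continuousOn v.continuousOn_val

theorem sqInt_d1 (v : H2 a b) : SqInt a b v.d1 := .of_continuousOn v.continuousOn_d1

/-- The element of `H²(a, b)` given by a function and its iterated primitives. -/
def ofPrimitive (hab : a ≤ b) (v w g : ℝ → ℝ) (hg : SqInt a b g) (h1 : IsPrimitive a b v w)
    (h2 : IsPrimitive a b w g) : H2 a b where
  val := v
  d1 := w
  d2 := g
  continuousOn_val := h1.continuousOn hab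
  continuousOn_d1 := h2.continuousOn hab
  memLp_d2 := hg
  weakDeriv_val := h1.hasWeakDeriv hab
  weakDeriv_d1 := h2.hasWeakDeriv hab

/-- The function with second derivative `g` and given value and slope at the left end. -/
def ofSecondDeriv (hab : a ≤ b) (c₀ c₁ : ℝ) (g : ℝ → ℝ) (hg : SqInt a b g) : H2 a b :=
  ofPrimitive hab (fun x => c₀ + ∫ s in a..x, (c₁ + ∫ r in a..s, g r))
    (fun s => c₁ + ∫ r in a..s, g r) g hg
    (.integral _ (by
      apply ContinuousOn.intervalIntegrable
      rw [uIcc_of_le hab]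
      exact (IsPrimitive.integral c₁ (hg.intervalIntegrable hab)).continuousOn hab))
    (.integral _ (hg.intervalIntegrable hab))

section ofSecondDeriv

variable (hab : a ≤ b) (c₀ c₁ : ℝ) (g : ℝ → ℝ) (hg : SqInt a b g)

@[simp] theorem ofSecondDeriv_val_left : (ofSecondDeriv hab c₀ c₁ g hg).val a = c₀ := by
  simp [ofSecondDeriv, ofPrimitive]

@[simp] theorem ofSecondDeriv_d1_left : (ofSecondDeriv hab c₀ c₁ g hg).d1 a = c₁ := by
  simp [ofSecondDeriv, ofPrimitive]

@[simp] theorem ofSecondDeriv_d2 : (ofSecondDeriv hab c₀ c₁ g hg).d2 = g := rfl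

end ofSecondDeriv

/-- The linear combination `v + c w`. -/
def lin (hab : a < b) (v w : H2 a b) (c : ℝ) : H2 a b :=
  ofPrimitive hab.le (fun x => v.val x + c * w.val x) (fun x => v.d1 x + c * w.d1 x)
    (fun x => v.d2 x + c * w.d2 x) (SqInt.lin v.memLp_d2 w.memLp_d2 c)
    ((v.isPrimitive_val hab).add ((w.isPrimitive_val hab).const_mul c))
    ((v.isPrimitive_d1 hab).add ((w.isPrimitive_d1 hab).const_mul c))

section lin

variable (hab : a < b) (v w : H2 a b) (c : ℝ)

@[simp] theorem lin_val : (lin hab v w c).val = fun x => v.val x + c * w.val x := rfl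
@[simp] theorem lin_d1 : (lin hab v w c).d1 = fun x => v.d1 x + c * w.d1 x := rfl
@[simp] theorem lin_d2 : (lin hab v w c).d2 = fun x => v.d2 x + c * w.d2 x := rfl

end lin

/-- The restriction to a subinterval. -/
def restrict (v : H2 a b) (hab : a < b) {c d : ℝ} (hac : a ≤ c) (hcd : c ≤ d) (hdb : d ≤ b) :
    H2 c d :=
  ofPrimitive hcd v.val v.d1 v.d2 (SqInt.mono v.memLp_d2 hac hdb)
    ((v.isPrimitive_val hab).mono hac hcd hdb) ((v.isPrimitive_d1 hab).mono hac hcd hdb)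

/-- Green's formula. -/
theorem green (hab : a < b) (v w : H2 a b) :
    (∫ x in a..b, v.d2 x * w.val x) - ∫ x in a..b, v.val x * w.d2 x
      = v.d1 b * w.val b - v.d1 a * w.val a - (v.val b * w.d1 b - v.val a * w.d1 a) := by
  have h1 := (v.isPrimitive_d1 hab).integral_mul_eq (w.isPrimitive_val hab) hab.le
  have h2 := (v.isPrimitive_val hab).integral_mul_eq (w.isPrimitive_d1 hab) hab.le
  linarith

/-- All boundary values vanish. -/
def ZeroTrace (z : H2 a b) : Prop := z.val a = 0 ∧ z.d1 a = 0 ∧ z.val b = 0 ∧ z.d1 b = 0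

end H2

theorem integral_affine (a b α β : ℝ) :
    ∫ x in a..b, (α + β * (x - a)) = α * (b - a) + β * (b - a) ^ 2 / 2 := by
  have : ∀ x, HasDerivAt (fun x => α * (x - a) + β * (x - a) ^ 2 / 2) (α + β * (x - a)) x := by
    intro x
    have h := (hasDerivAt_id x).sub_const a
    convert! (h.const_mul α).add (((h.pow 2).const_mul β).div_const 2) using 1
    simp; ring
  rw [intervalIntegral.integral_eq_sub_of_hasDerivAt (fun x _ => this x)]
  · ring
  · apply Continuous.intervalIntegrable; fun_prop

/-- Affine moments of the second derivative are given by boundary values. -/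
theorem H2.integral_affine_mul_d2 {a b : ℝ} (hab : a < b) (z : H2 a b) (α β : ℝ) :
    ∫ x in a..b, (α + β * (x - a)) * z.d2 x
      = (α + β * (b - a)) * z.d1 b - α * z.d1 a - β * (z.val b - z.val a) := by
  have h1 : IsPrimitive a b (fun x => α + β * (x - a)) (fun _ => β) := by
    apply IsPrimitive.of_hasDerivAt _ continuous_const
    intro x
    have h := (hasDerivAt_id x).sub_const a
    simpa using (h.const_mul β).const_add α
  have h2 := h1.integral_mul_eq (z.isPrimitive_d1 hab) hab.le
  have h3 := (z.isPrimitive_val hab).sub_eq le_rfl hab.le le_rfl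
  rw [intervalIntegral.integral_const_mul, ← h3] at h2
  simp only [sub_self, mul_zero, add_zero] at h2
  linarith

/-- An `L₂` function with a second derivative in `L₂`, in the sense of duality with functions of
zero trace, belongs to `H²`. -/
theorem exists_H2_of_weak {a b : ℝ} (hab : a < b) {V W : ℝ → ℝ} (hV : SqInt a b V)
    (hW : SqInt a b W)
    (h : ∀ z : H2 a b, z.ZeroTrace → ∫ x in a..b, V x * z.d2 x = ∫ x in a..b, W x * z.val x) :
    ∃ R : H2 a b, R.val =ᵐ[volume.restrict (Ioo a b)] V ∧ R.d2 = W := by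
  let V₀ := H2.ofSecondDeriv hab.le 0 0 W hW
  have hD : SqInt a b (fun x => V x + (-1) * V₀.val x) := hV.lin V₀.sqInt_val (-1)
  set D := fun x => V x + (-1) * V₀.val x with hDdef
  set L := b - a with hL
  have hL0 : 0 < L := sub_pos.2 hab
  have haff : ∀ α β : ℝ, SqInt a b (fun x => α + β * (x - a)) := fun α β =>
    .of_continuousOn (by fun_prop)
  set m₀ := ∫ x in a..b, D x with hm₀
  set m₁ := ∫ x in a..b, (x - a) * D x with hm₁
  -- Coefficients of the L₂ projection of `D` onto affine functions: they solve the 2 × 2 moment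
  -- system, so that the remainder `r` has vanishing moments of order 0 and 1.
  let α := 4 * m₀ / L - 6 * m₁ / L ^ 2
  let β := 12 * m₁ / L ^ 3 - 6 * m₀ / L ^ 2
  have hr : SqInt a b (fun x => D x + (-1) * (α + β * (x - a))) := hD.lin (haff α β) (-1)
  set r := fun x => D x + (-1) * (α + β * (x - a)) with hrdef
  have hx1 : SqInt a b (fun x => x - a) := .of_continuousOn (by fun_prop)
  have hr0 : ∫ x in a..b, r x = 0 := by
    rw [hrdef, intervalIntegral.integral_add (hD.intervalIntegrable hab.le)
      (((haff α β).intervalIntegrable hab.le).const_mul _), intervalIntegral.integral_const_mul,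
      integral_affine, ← hm₀]
    simp only [α, β, ← hL]
    field_simp
    ring
  have hint2 : ∫ x in a..b, (x - a) * (α + β * (x - a)) = α * L ^ 2 / 2 + β * L ^ 3 / 3 := by
    have : ∀ x, HasDerivAt (fun x => α * (x - a) ^ 2 / 2 + β * (x - a) ^ 3 / 3)
        ((x - a) * (α + β * (x - a))) x := by
      intro x
      have h := (hasDerivAt_id x).sub_const a
      convert! (((h.pow 2).const_mul α).div_const 2).add (((h.pow 3).const_mul β).div_const 3)
        using 1
      simp; ring
    rw [intervalIntegral.integral_eq_sub_of_hasDerivAt (fun x _ => this x)]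
    · simp [hL]
    · apply Continuous.intervalIntegrable; fun_prop
  have hr1 : ∫ x in a..b, (x - a) * r x = 0 := by
    have e : ∀ x, (x - a) * r x = (x - a) * D x - (x - a) * (α + β * (x - a)) := fun x => by
      simp only [hrdef]; ring
    simp_rw [e]
    rw [intervalIntegral.integral_sub (hx1.mul_intervalIntegrable hD hab.le)
      (hx1.mul_intervalIntegrable (haff α β) hab.le), hint2, ← hm₁]
    simp only [α, β]
    field_simp
    ring
  -- With zero data at the left end, the data of `z` at the right end are combinations of the two
  -- moments of z'' = r. Hence `z` has zero trace and is an admissible test function.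
  let z := H2.ofSecondDeriv hab.le 0 0 r hr
  have hz1 : z.d1 b = 0 := by
    have := (z.isPrimitive_d1 hab).sub_eq le_rfl hab.le le_rfl
    simpa [z, hr0] using this
  have hz0 : z.val b = 0 := by
    have := z.integral_affine_mul_d2 hab 0 1
    simp only [zero_add, one_mul, hz1, mul_zero, zero_mul, sub_zero] at this
    simp only [z, H2.ofSecondDeriv_d2, hr1, H2.ofSecondDeriv_val_left] at this
    simpa using this.symm
  have hz : z.ZeroTrace := ⟨by simp [z], by simp [z], hz0, hz1⟩
  have g1 := h z hz
  have g2 := H2.green hab V₀ z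
  simp only [hz.1, hz.2.1, hz.2.2.1, hz.2.2.2, mul_zero, sub_zero] at g2
  have g3 : ∫ x in a..b, (α + β * (x - a)) * z.d2 x = 0 := by
    rw [z.integral_affine_mul_d2 hab, hz.1, hz.2.1, hz.2.2.1, hz.2.2.2]; ring
  have hz2 : z.d2 = r := rfl
  have hV2 : V₀.d2 = W := rfl
  rw [hz2] at g1 g2 g3
  rw [hV2] at g2
  -- `r` is orthogonal to affine functions, and to V - V₀ by the hypothesis and Green's formula;
  -- since `r` is a combination of these, it is orthogonal to itself. Thus V - V₀ is affine.
  have hsq : ∫ x in a..b, r x ^ 2 = 0 := by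
    have e : ∀ x, r x ^ 2 = V x * r x - V₀.val x * r x - (α + β * (x - a)) * r x := fun x => by
      simp only [hrdef, hDdef]; ring
    simp_rw [e]
    rw [intervalIntegral.integral_sub ((hV.mul_intervalIntegrable hr hab.le).sub
      (V₀.sqInt_val.mul_intervalIntegrable hr hab.le))
      ((haff α β).mul_intervalIntegrable hr hab.le),
      intervalIntegral.integral_sub (hV.mul_intervalIntegrable hr hab.le)
      (V₀.sqInt_val.mul_intervalIntegrable hr hab.le), g3]
    linarith
  have hae := ae_eq_zero_of_integral_sq hab.le hr hsq
  have hp : IsPrimitive a b (fun x => α + β * (x - a)) (fun _ => β) := by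
    apply IsPrimitive.of_hasDerivAt _ continuous_const
    intro x
    have h := (hasDerivAt_id x).sub_const a
    simpa using (h.const_mul β).const_add α
  have hp' : IsPrimitive a b (fun _ => β) (fun _ => (0 : ℝ)) :=
    IsPrimitive.of_hasDerivAt (fun x => hasDerivAt_const x β) continuous_const
  refine ⟨H2.ofPrimitive hab.le (fun x => V₀.val x + (α + β * (x - a))) (fun x => V₀.d1 x + β)
    W hW ((V₀.isPrimitive_val hab).add hp) ?_, ?_, rfl⟩
  · simpa [hV2] using (V₀.isPrimitive_d1 hab).add hp'
  · filter_upwards [hae] with x hx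
    simp only [hrdef, hDdef, Pi.zero_apply] at hx
    simp only [H2.ofPrimitive]
    linarith

end

/-! ### Riesz representation, Hermite interpolation and the trace norm on one element -/

section
/-- The Riesz representation theorem in `H²(a, b)`, with the inner product
`(v, w) + (v'', w'')`. -/
theorem exists_riesz {a b : ℝ} (hab : a < b) {g k : ℝ → ℝ} (hg : SqInt a b g) (hk : SqInt a b k) :
    ∃ R : H2 a b, ∀ v : H2 a b,
      (∫ x in a..b, R.val x * v.val x) + ∫ x in a..b, R.d2 x * v.d2 x
        = (∫ x in a..b, g x * v.val x) + ∫ x in a..b, k x * v.d2 x := by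
  let X := Lp ℝ 2 (volume.restrict (Ioo a b))
  -- The orthogonal complement `K` of these pairs (z'', -z) is the graph {(v, v'')} of H²: one
  -- inclusion is Green's formula, the other `exists_H2_of_weak`. Being a complement it is closed,
  -- and the representative sought is the projection of (g, k) onto it.
  let S : Set (WithLp 2 (X × X)) := {e | ∃ z : H2 a b, z.ZeroTrace ∧
    e = WithLp.toLp 2 (MemLp.toLp _ z.memLp_d2, -MemLp.toLp _ z.sqInt_val)}
  let K := (Submodule.span ℝ S)ᗮ
  let e : WithLp 2 (X × X) := WithLp.toLp 2 (hg.toLp, hk.toLp)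
  have hKmem : ∀ w, w ∈ K ↔ ∀ z : H2 a b, z.ZeroTrace →
      ∫ x in a..b, (w.fst : X) x * z.d2 x = ∫ x in a..b, (w.snd : X) x * z.val x := by
    intro w
    have h0 : ∀ z : H2 a b, inner ℝ (WithLp.toLp 2 (MemLp.toLp _ z.memLp_d2,
        -MemLp.toLp _ z.sqInt_val) : WithLp 2 (X × X)) w
        = (∫ x in a..b, (w.fst : X) x * z.d2 x) - ∫ x in a..b, (w.snd : X) x * z.val x := by
      intro z
      rw [real_inner_comm, WithLp.prod_inner_apply, inner_neg_right,
        inner_toLp_right hab.le, inner_toLp_right hab.le]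
      rfl
    constructor
    · intro hw z hz
      have := hw _ (Submodule.subset_span ⟨z, hz, rfl⟩)
      rw [h0] at this
      exact sub_eq_zero.1 this
    · intro h
      rw [Submodule.mem_orthogonal]
      intro u hu
      induction hu using Submodule.span_induction with
      | mem x hx =>
        obtain ⟨z, hz, rfl⟩ := hx
        rw [h0, h z hz, sub_self]
      | zero => simp
      | add x y _ _ hx hy => rw [inner_add_left, hx, hy, add_zero]
      | smul c x _ hx => rw [inner_smul_left, hx, mul_zero]
  have hKc : CompleteSpace K :=
    (Submodule.isClosed_orthogonal (Submodule.span ℝ S)).completeSpace_coe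
  have hKp : K.HasOrthogonalProjection := Submodule.HasOrthogonalProjection.ofCompleteSpace K
  obtain ⟨P, hP, hPe⟩ := Submodule.HasOrthogonalProjection.exists_orthogonal (K := K) e
  obtain ⟨R, hR, hR2⟩ := exists_H2_of_weak hab (Lp.memLp P.fst) (Lp.memLp P.snd) ((hKmem P).1 hP)
  refine ⟨R, fun v => ?_⟩
  have hv : (WithLp.toLp 2 (MemLp.toLp _ v.sqInt_val, MemLp.toLp _ v.memLp_d2) :
      WithLp 2 (X × X)) ∈ K := by
    rw [hKmem]
    intro z hz
    have h1 := v.green hab z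
    rw [hz.1, hz.2.1, hz.2.2.1, hz.2.2.2] at h1
    have e1 := inner_toLp hab.le v.sqInt_val z.memLp_d2
    have e2 := inner_toLp hab.le v.memLp_d2 z.sqInt_val
    rw [inner_toLp_right hab.le] at e1 e2
    change ∫ x in a..b, (MemLp.toLp _ v.sqInt_val : X) x * z.d2 x
      = ∫ x in a..b, (MemLp.toLp _ v.memLp_d2 : X) x * z.val x
    rw [e1, e2]
    linarith
  have horth := hPe _ hv
  have r1 := inner_toLp_right hab.le P.fst v.sqInt_val
  have r2 := inner_toLp_right hab.le P.snd v.memLp_d2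
  rw [inner_sub_right, sub_eq_zero, real_inner_comm, real_inner_comm P,
    WithLp.prod_inner_apply, WithLp.prod_inner_apply] at horth
  change inner ℝ hg.toLp _ + inner ℝ hk.toLp _ = inner ℝ P.fst _ + inner ℝ P.snd _ at horth
  rw [inner_toLp hab.le hg v.sqInt_val, inner_toLp hab.le hk v.memLp_d2, r1, r2] at horth
  rw [horth, hR2]
  congr 1
  apply intervalIntegral_congr_Ioo hab.le
  filter_upwards [hR] with x hx
  rw [hx]

theorem integral_poly_six (a b e₀ e₁ e₂ e₃ e₄ e₅ e₆ : ℝ) :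
    ∫ x in a..b, (e₀ + e₁ * (x - a) + e₂ * (x - a) ^ 2 + e₃ * (x - a) ^ 3 + e₄ * (x - a) ^ 4
      + e₅ * (x - a) ^ 5 + e₆ * (x - a) ^ 6)
      = e₀ * (b - a) + e₁ * (b - a) ^ 2 / 2 + e₂ * (b - a) ^ 3 / 3 + e₃ * (b - a) ^ 4 / 4
        + e₄ * (b - a) ^ 5 / 5 + e₅ * (b - a) ^ 6 / 6 + e₆ * (b - a) ^ 7 / 7 := by
  have : ∀ x, HasDerivAt (fun x => e₀ * (x - a) + e₁ * (x - a) ^ 2 / 2 + e₂ * (x - a) ^ 3 / 3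
      + e₃ * (x - a) ^ 4 / 4 + e₄ * (x - a) ^ 5 / 5 + e₅ * (x - a) ^ 6 / 6
      + e₆ * (x - a) ^ 7 / 7)
      (e₀ + e₁ * (x - a) + e₂ * (x - a) ^ 2 + e₃ * (x - a) ^ 3 + e₄ * (x - a) ^ 4
      + e₅ * (x - a) ^ 5 + e₆ * (x - a) ^ 6) x := by
    intro x
    have h := (hasDerivAt_id x).sub_const a
    have hp : ∀ (n : ℕ) (e : ℝ), HasDerivAt (fun x => e * (x - a) ^ n / n)
        (e * (n * (x - a) ^ (n - 1) * 1) / n) x := fun n e =>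
      ((h.pow n).const_mul e).div_const n
    have h0 : HasDerivAt (fun x => e₀ * (x - a)) (e₀ * 1) x := h.const_mul e₀
    convert! (((((h0.add (hp 2 e₁)).add (hp 3 e₂)).add (hp 4 e₃)).add (hp 5 e₄)).add
      (hp 6 e₅)).add (hp 7 e₆) using 1
    norm_num
    ring
  rw [intervalIntegral.integral_eq_sub_of_hasDerivAt (fun x _ => this x)]
  · simp
  · apply Continuous.intervalIntegrable; fun_prop

namespace H2

/-- Cubic polynomials as elements of `H²`. -/
def cubic {a b : ℝ} (hab : a ≤ b) (c₀ c₁ c₂ c₃ : ℝ) : H2 a b :=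
  have hq : IsPrimitive a b (fun x => c₁ + 2 * c₂ * (x - a) + 3 * c₃ * (x - a) ^ 2)
      (fun x => 2 * c₂ + 6 * c₃ * (x - a)) := by
    refine .of_hasDerivAt (fun x => ?_) (by fun_prop)
    have h := (hasDerivAt_id x).sub_const a
    convert! ((h.const_mul (2 * c₂)).const_add c₁).add ((h.pow 2).const_mul (3 * c₃)) using 1
    simp; ring
  have hp : IsPrimitive a b
      (fun x => c₀ + c₁ * (x - a) + c₂ * (x - a) ^ 2 + c₃ * (x - a) ^ 3)
      (fun x => c₁ + 2 * c₂ * (x - a) + 3 * c₃ * (x - a) ^ 2) := by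
    refine .of_hasDerivAt (fun x => ?_) (by fun_prop)
    have h := (hasDerivAt_id x).sub_const a
    convert! (((h.const_mul c₁).const_add c₀).add ((h.pow 2).const_mul c₂)).add
      ((h.pow 3).const_mul c₃) using 1
    simp; ring
  ofPrimitive hab _ _ _ (.of_continuousOn (by fun_prop)) hp hq

/-- The cubic Hermite interpolant of boundary data `(v₀, d₀, v₁, d₁)`. -/
def hermite {a b : ℝ} (hab : a ≤ b) (p : Fin 4 → ℝ) : H2 a b :=
  cubic hab (p 0) (p 1) (3 * (p 2 - p 0) / (b - a) ^ 2 - (2 * p 1 + p 3) / (b - a))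
    (2 * (p 0 - p 2) / (b - a) ^ 3 + (p 1 + p 3) / (b - a) ^ 2)

section hermite

variable {a b : ℝ} (hab : a < b) (p : Fin 4 → ℝ)

@[simp] theorem hermite_val_left : (hermite hab.le p).val a = p 0 := by
  simp [hermite, cubic, ofPrimitive]

@[simp] theorem hermite_d1_left : (hermite hab.le p).d1 a = p 1 := by
  simp [hermite, cubic, ofPrimitive]

@[simp] theorem hermite_val_right : (hermite hab.le p).val b = p 2 := by
  have : b - a ≠ 0 := (sub_pos.2 hab).ne'
  simp only [hermite, cubic, ofPrimitive]
  field_simp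
  ring

@[simp] theorem hermite_d1_right : (hermite hab.le p).d1 b = p 3 := by
  have : b - a ≠ 0 := (sub_pos.2 hab).ne'
  simp only [hermite, cubic, ofPrimitive]
  field_simp
  ring

/-- Being affine, this second derivative is L₂ orthogonal to the second derivative of every function
of zero trace. -/
theorem hermite_d2 : ∃ α β : ℝ, (hermite hab.le p).d2 = fun x => α + β * (x - a) := ⟨_, _, rfl⟩

/-- This is the meaning of the explicit quadratic form: the squared graph norm of the cubic Hermite
interpolant, obtained by integrating polynomials. -/
theorem integral_hermite_sq : (∫ x in a..b, (hermite hab.le p).val x ^ 2)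
    + ∫ x in a..b, (hermite hab.le p).d2 x ^ 2 = elemNormSq (b - a) p := by
  have hne : b - a ≠ 0 := (sub_pos.2 hab).ne'
  have h1 : ∀ c₀ c₁ c₂ c₃ : ℝ, ∫ x in a..b, (cubic hab.le c₀ c₁ c₂ c₃).val x ^ 2
      = c₀ ^ 2 * (b - a) + (2 * c₀ * c₁) * (b - a) ^ 2 / 2
        + (c₁ ^ 2 + 2 * c₀ * c₂) * (b - a) ^ 3 / 3
        + (2 * c₀ * c₃ + 2 * c₁ * c₂) * (b - a) ^ 4 / 4
        + (c₂ ^ 2 + 2 * c₁ * c₃) * (b - a) ^ 5 / 5 + (2 * c₂ * c₃) * (b - a) ^ 6 / 6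
        + c₃ ^ 2 * (b - a) ^ 7 / 7 := by
    intro c₀ c₁ c₂ c₃
    rw [← integral_poly_six]
    congr 1
    funext x
    simp only [cubic, ofPrimitive]
    ring
  have h2 : ∀ c₀ c₁ c₂ c₃ : ℝ, ∫ x in a..b, (cubic hab.le c₀ c₁ c₂ c₃).d2 x ^ 2
      = (4 * c₂ ^ 2) * (b - a) + (24 * c₂ * c₃) * (b - a) ^ 2 / 2
        + (36 * c₃ ^ 2) * (b - a) ^ 3 / 3 + 0 * (b - a) ^ 4 / 4
        + 0 * (b - a) ^ 5 / 5 + 0 * (b - a) ^ 6 / 6 + 0 * (b - a) ^ 7 / 7 := by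
    intro c₀ c₁ c₂ c₃
    rw [← integral_poly_six]
    congr 1
    funext x
    simp only [cubic, ofPrimitive]
    ring
  rw [hermite, h1, h2]
  simp only [elemNormSq]
  field_simp
  ring

end hermite

theorem integral_sq_nonneg {a b : ℝ} (hab : a ≤ b) (f : ℝ → ℝ) : 0 ≤ ∫ x in a..b, f x ^ 2 :=
  intervalIntegral.integral_nonneg hab fun _ _ => sq_nonneg _

end H2

/-- Cauchy-Schwarz for primitives. -/
theorem IsPrimitive.sq_sub_le {a b : ℝ} {v w : ℝ → ℝ} (h : IsPrimitive a b v w)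
    (hw : SqInt a b w) {x : ℝ} (hx : x ∈ Icc a b) :
    (v x - v a) ^ 2 ≤ (b - a) * ∫ s in a..b, w s ^ 2 := by
  rw [h.sub_eq le_rfl hx.1 hx.2]
  have h1 := integral_mul_sq_le hx.1 (f := fun _ => 1) (.of_continuousOn (by fun_prop))
    (hw.mono le_rfl hx.2)
  simp only [one_mul, one_pow, intervalIntegral.integral_const, smul_eq_mul, mul_one] at h1
  refine h1.trans (mul_le_mul (by linarith [hx.2]) ?_ (H2.integral_sq_nonneg hx.1 _)
    (by linarith [hx.1, hx.2]))
  apply intervalIntegral.integral_mono_interval le_rfl hx.1 hx.2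
  · exact ae_of_all _ fun s => sq_nonneg _
  · simpa [sq] using hw.mul_intervalIntegrable hw (hx.1.trans hx.2)

theorem integral_sq_le_of_abs_le {a b : ℝ} (hab : a ≤ b) {f : ℝ → ℝ} {C : ℝ}
    (hf : ContinuousOn f (Icc a b)) (h : ∀ x ∈ Icc a b, f x ^ 2 ≤ C) :
    ∫ x in a..b, f x ^ 2 ≤ (b - a) * C := by
  have := intervalIntegral.integral_mono_on (g := fun _ => C) (f := fun x => f x ^ 2)
    (μ := volume) hab (by
      apply ContinuousOn.intervalIntegrable
      rw [uIcc_of_le hab]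
      exact hf.pow 2) (by simp) h
  simpa using this

/-- The Friedrichs inequality for functions with vanishing data at the left end. -/
theorem H2.integral_val_sq_le {a b : ℝ} (hab : a < b) (e : H2 a b) (h0 : e.val a = 0)
    (h1 : e.d1 a = 0) :
    ∫ x in a..b, e.val x ^ 2 ≤ (b - a) ^ 4 * ∫ x in a..b, e.d2 x ^ 2 := by
  have hL : 0 ≤ b - a := (sub_pos.2 hab).le
  have i1 : ∫ x in a..b, e.d1 x ^ 2 ≤ (b - a) * ((b - a) * ∫ x in a..b, e.d2 x ^ 2) :=
    integral_sq_le_of_abs_le hab.le e.continuousOn_d1 fun x hx => by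
      simpa [h1] using (e.isPrimitive_d1 hab).sq_sub_le e.memLp_d2 hx
  have i0 : ∫ x in a..b, e.val x ^ 2 ≤ (b - a) * ((b - a) * ∫ x in a..b, e.d1 x ^ 2) :=
    integral_sq_le_of_abs_le hab.le e.continuousOn_val fun x hx => by
      simpa [h0] using (e.isPrimitive_val hab).sq_sub_le e.sqInt_d1 hx
  calc _ ≤ _ := i0
    _ ≤ (b - a) * ((b - a) * ((b - a) * ((b - a) * ∫ x in a..b, e.d2 x ^ 2))) := by gcongr
    _ = _ := by ring

theorem integral_add_sq {a b : ℝ} (hab : a ≤ b) {f g : ℝ → ℝ} (hf : SqInt a b f)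
    (hg : SqInt a b g) : ∫ x in a..b, (f x + g x) ^ 2
      = (∫ x in a..b, f x ^ 2) + 2 * (∫ x in a..b, f x * g x) + ∫ x in a..b, g x ^ 2 := by
  have e : ∀ x, (f x + g x) ^ 2 = f x * f x + 2 * (f x * g x) + g x * g x := fun x => by ring
  simp_rw [e]
  rw [intervalIntegral.integral_add, intervalIntegral.integral_add,
    intervalIntegral.integral_const_mul]
  · simp_rw [sq]
  · exact hf.mul_intervalIntegrable hf hab
  · exact (hf.mul_intervalIntegrable hg hab).const_mul 2
  · exact (hf.mul_intervalIntegrable hf hab).add ((hf.mul_intervalIntegrable hg hab).const_mul 2)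
  · exact hg.mul_intervalIntegrable hg hab

theorem integral_add_sq_le {a b : ℝ} (hab : a ≤ b) {f g : ℝ → ℝ} (hf : SqInt a b f)
    (hg : SqInt a b g) : ∫ x in a..b, (f x + g x) ^ 2
      ≤ 2 * (∫ x in a..b, f x ^ 2) + 2 * ∫ x in a..b, g x ^ 2 := by
  have h1 := integral_add_sq hab hf hg
  have h2 := integral_add_sq hab hf (hg.const_mul (-1))
  have h3 := H2.integral_sq_nonneg hab (fun x => f x + -1 * g x)
  have e1 : ∀ x, f x * (-1 * g x) = -1 * (f x * g x) := fun x => by ring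
  have e2 : ∀ x, (-1 * g x) ^ 2 = g x ^ 2 := fun x => by ring
  simp_rw [e1, e2, intervalIntegral.integral_const_mul] at h2
  linarith

/-- The discrete trace norm is bounded by the `H²` norm. -/
theorem H2.elemNormSq_trace_le {a b : ℝ} (hab : a < b) (hb : b - a ≤ 1) (v : H2 a b) :
    elemNormSq (b - a) ![v.val a, v.d1 a, v.val b, v.d1 b]
      ≤ 2 * (∫ x in a..b, v.val x ^ 2) + 3 * ∫ x in a..b, v.d2 x ^ 2 := by
  set p : Fin 4 → ℝ := ![v.val a, v.d1 a, v.val b, v.d1 b] with hp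
  let H := hermite hab.le p
  let e := lin hab v H (-1)
  have e0 : e.val a = 0 := by simp [e, H, hab, hp]
  have e1 : e.d1 a = 0 := by simp [e, H, hab, hp]
  have e2 : e.val b = 0 := by simp [e, H, hab, hp]
  have e3 : e.d1 b = 0 := by simp [e, H, hab, hp]
  -- The interpolation error `e` has zero trace, so ‖v''‖² splits as ‖H''‖² + ‖e''‖². The L₂ part of
  -- `H` is then bounded by that of `v` and, through the Friedrichs inequality with b - a ≤ 1, by
  -- ‖e''‖.
  have horth : ∫ x in a..b, H.d2 x * e.d2 x = 0 := by
    obtain ⟨α, β, h⟩ := hermite_d2 hab p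
    change ∫ x in a..b, (hermite hab.le p).d2 x * e.d2 x = 0
    rw [h, e.integral_affine_mul_d2 hab, e0, e1, e2, e3]
    ring
  have q1 := integral_add_sq hab.le H.memLp_d2 e.memLp_d2
  have q2 := e.integral_val_sq_le hab e0 e1
  have q3 := integral_add_sq_le hab.le v.sqInt_val (e.sqInt_val.const_mul (-1))
  have c1 : ∀ x, H.d2 x + e.d2 x = v.d2 x := fun x => by simp [e]
  have c2 : ∀ x, v.val x + -1 * e.val x = H.val x := fun x => by simp [e]
  have c3 : ∀ x, (-1 * e.val x) ^ 2 = e.val x ^ 2 := fun x => by ring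
  simp_rw [c1] at q1
  simp_rw [c2, c3] at q3
  have q4 : (b - a) ^ 4 ≤ 1 := pow_le_one₀ (sub_pos.2 hab).le hb
  have p1 := integral_sq_nonneg hab.le H.d2
  have p2 := integral_sq_nonneg hab.le e.d2
  have q5 : (b - a) ^ 4 * ∫ x in a..b, e.d2 x ^ 2 ≤ 1 * ∫ x in a..b, e.d2 x ^ 2 := by gcongr
  rw [← integral_hermite_sq hab p]
  change (∫ x in a..b, H.val x ^ 2) + ∫ x in a..b, H.d2 x ^ 2 ≤ _
  linarith

end

/-! ### Meshes, broken spaces and continuity of the bilinear form -/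

section
namespace Mesh

variable {n : ℕ} (𝒯 : Mesh n)

theorem left_lt_right (j : Fin n) : 𝒯.left j < 𝒯.right j :=
  𝒯.strictMono_node (Fin.castSucc_lt_succ (i := j))

theorem left_nonneg (j : Fin n) : 0 ≤ 𝒯.left j := by
  rw [← 𝒯.node_zero]; exact 𝒯.strictMono_node.monotone (Fin.zero_le _)

theorem right_le_one (j : Fin n) : 𝒯.right j ≤ 1 := by
  rw [← 𝒯.node_last]; exact 𝒯.strictMono_node.monotone (Fin.le_last _)

theorem right_le_left {i j : Fin n} (h : i < j) : 𝒯.right i ≤ 𝒯.left j :=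
  𝒯.strictMono_node.monotone (Fin.succ_le_castSucc_iff.2 h)

theorem h_le_one (j : Fin n) : 𝒯.right j - 𝒯.left j ≤ 1 := by
  linarith [𝒯.left_nonneg j, 𝒯.right_le_one j]

theorem sum_sub_eq (F : ℝ → ℝ) : ∑ j, (F (𝒯.right j) - F (𝒯.left j)) = F 1 - F 0 := by
  have key : ∀ (m : ℕ) (x : Fin (m + 1) → ℝ),
      ∑ j : Fin m, (F (x j.succ) - F (x j.castSucc)) = F (x (Fin.last m)) - F (x 0) := by
    intro m
    induction m with
    | zero => intro x; simp
    | succ m ih =>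
      intro x
      rw [Fin.sum_univ_castSucc]
      have := ih fun j => x j.castSucc
      simp only [Fin.castSucc_zero] at this
      simp only [Fin.succ_last, Fin.succ_castSucc, this]
      ring
  have := key n 𝒯.node
  rw [𝒯.node_zero, 𝒯.node_last] at this
  exact this

theorem sum_integral_eq {g : ℝ → ℝ} (hg : IntervalIntegrable g volume 0 1) :
    ∑ j, ∫ x in 𝒯.left j..𝒯.right j, g x = ∫ x in (0 : ℝ)..1, g x := by
  have := 𝒯.sum_sub_eq fun x => ∫ s in (0 : ℝ)..x, g s
  rw [intervalIntegral.integral_same, sub_zero] at this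
  rw [← this]
  refine Finset.sum_congr rfl fun j _ => ?_
  have h1 := (𝒯.left_lt_right j).le
  rw [intervalIntegral.integral_interval_sub_left]
  · exact intervalIntegrable_mono_of_le hg le_rfl ((𝒯.left_nonneg j).trans h1) (𝒯.right_le_one j)
  · exact intervalIntegrable_mono_of_le hg le_rfl (𝒯.left_nonneg j) (h1.trans (𝒯.right_le_one j))

end Mesh

/-- The function on `I` with given restrictions to the elements. -/
def glue {n : ℕ} (𝒯 : Mesh n) (w : Fin n → ℝ → ℝ) (x : ℝ) : ℝ :=
  ∑ j, (Ioo (𝒯.left j) (𝒯.right j)).indicator (w j) x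

section glue

variable {n : ℕ} {𝒯 : Mesh n} {w w' : Fin n → ℝ → ℝ}

theorem glue_eq {j : Fin n} {x : ℝ} (hx : x ∈ Ioo (𝒯.left j) (𝒯.right j)) :
    glue 𝒯 w x = w j x := by
  rw [glue, Finset.sum_eq_single j, indicator_of_mem hx]
  · intro i _ hij
    apply indicator_of_notMem
    intro hi
    rcases lt_or_gt_of_ne hij with h | h
    · exact absurd (hi.2.trans_le (𝒯.right_le_left h)) (not_lt.2 hx.1.le)
    · exact absurd (hx.2.trans_le (𝒯.right_le_left h)) (not_lt.2 hi.1.le)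
  · simp

theorem sqInt_glue (hw : ∀ j, SqInt (𝒯.left j) (𝒯.right j) (w j)) : SqInt 0 1 (glue 𝒯 w) := by
  have : glue 𝒯 w = ∑ j, (Ioo (𝒯.left j) (𝒯.right j)).indicator (w j) := by
    funext x; simp [glue]
  rw [this]
  refine memLp_finsetSum' _ fun j _ => ?_
  have h := (memLp_indicator_iff_restrict (p := 2) (f := w j) (μ := volume)
    (measurableSet_Ioo (a := 𝒯.left j) (b := 𝒯.right j))).2 (hw j)
  exact h.mono_measure Measure.restrict_le_self

theorem intervalIntegral_congr_elem {j : Fin n} {f g : ℝ → ℝ}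
    (h : ∀ x ∈ Ioo (𝒯.left j) (𝒯.right j), f x = g x) :
    ∫ x in 𝒯.left j..𝒯.right j, f x = ∫ x in 𝒯.left j..𝒯.right j, g x :=
  intervalIntegral_congr_Ioo (𝒯.left_lt_right j).le
    ((ae_restrict_iff' measurableSet_Ioo).2 (ae_of_all _ h))

/-- `glue` as an element of `L₂(I)`. -/
def glueL2 (𝒯 : Mesh n) (w : Fin n → ℝ → ℝ) (hw : ∀ j, SqInt (𝒯.left j) (𝒯.right j) (w j)) :
    L2I := (sqInt_glue hw).toLp

theorem inner_glueL2_right (u : L2I) (hw : ∀ j, SqInt (𝒯.left j) (𝒯.right j) (w j)) :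
    inner ℝ u (glueL2 𝒯 w hw) = ∑ j, ∫ x in 𝒯.left j..𝒯.right j, u x * w j x := by
  rw [glueL2, inner_toLp_right zero_le_one, ← 𝒯.sum_integral_eq]
  · exact Finset.sum_congr rfl fun j _ => intervalIntegral_congr_elem fun x hx => by rw [glue_eq hx]
  · exact SqInt.mul_intervalIntegrable (Lp.memLp u) (sqInt_glue hw) zero_le_one

theorem inner_glueL2 (hw : ∀ j, SqInt (𝒯.left j) (𝒯.right j) (w j))
    (hw' : ∀ j, SqInt (𝒯.left j) (𝒯.right j) (w' j)) :
    inner ℝ (glueL2 𝒯 w hw) (glueL2 𝒯 w' hw')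
      = ∑ j, ∫ x in 𝒯.left j..𝒯.right j, w j x * w' j x := by
  rw [glueL2, glueL2, inner_toLp zero_le_one, ← 𝒯.sum_integral_eq]
  · exact Finset.sum_congr rfl fun j _ => intervalIntegral_congr_elem fun x hx => by
      rw [glue_eq hx, glue_eq hx]
  · exact (sqInt_glue hw).mul_intervalIntegrable (sqInt_glue hw') zero_le_one

theorem glueL2_lin (hw : ∀ j, SqInt (𝒯.left j) (𝒯.right j) (w j))
    (hw' : ∀ j, SqInt (𝒯.left j) (𝒯.right j) (w' j)) (c : ℝ)
    (hs : ∀ j, SqInt (𝒯.left j) (𝒯.right j) (fun x => w j x + c * w' j x)) :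
    glueL2 𝒯 (fun j x => w j x + c * w' j x) hs = glueL2 𝒯 w hw + c • glueL2 𝒯 w' hw' := by
  rw [glueL2, glueL2, glueL2, ← MemLp.toLp_const_smul, ← MemLp.toLp_add]
  congr 1
  funext x
  simp only [glue, Pi.add_apply, Pi.smul_apply, smul_eq_mul, Finset.mul_sum,
    ← Finset.sum_add_distrib]
  refine Finset.sum_congr rfl fun j _ => ?_
  by_cases hx : x ∈ Ioo (𝒯.left j) (𝒯.right j) <;> simp [hx]

end glue

namespace BrokenH2

variable {n : ℕ} {𝒯 : Mesh n}

/-- The `L₂` function underlying a piecewise `H²` function. -/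
def toL2 (z : BrokenH2 𝒯) : L2I := glueL2 𝒯 (fun j => (z j).val) fun j => (z j).sqInt_val

/-- The piecewise second derivative. -/
def secondDeriv (z : BrokenH2 𝒯) : L2I := glueL2 𝒯 (fun j => (z j).d2) fun j => (z j).memLp_d2

/-- The linear combination `z + c w`. -/
def lin (z w : BrokenH2 𝒯) (c : ℝ) : BrokenH2 𝒯 :=
  fun j => H2.lin (𝒯.left_lt_right j) (z j) (w j) c

theorem toL2_lin (z w : BrokenH2 𝒯) (c : ℝ) : toL2 (lin z w c) = toL2 z + c • toL2 w :=
  glueL2_lin (fun j => (z j).sqInt_val) (fun j => (w j).sqInt_val) c _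

theorem secondDeriv_lin (z w : BrokenH2 𝒯) (c : ℝ) :
    secondDeriv (lin z w c) = secondDeriv z + c • secondDeriv w :=
  glueL2_lin (fun j => (z j).memLp_d2) (fun j => (w j).memLp_d2) c _

/-- The Hermite interpolant of element-wise boundary data. -/
def hermite (𝒯 : Mesh n) (q : TraceData n) : BrokenH2 𝒯 :=
  fun j => H2.hermite (𝒯.left_lt_right j).le (q j)

theorem brokenTrace_hermite (q : TraceData n) : brokenTrace 𝒯 (hermite 𝒯 q) = q := by
  funext j i
  have h := 𝒯.left_lt_right j
  fin_cases i <;> simp [brokenTrace, hermite, h]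

theorem norm_toL2_sq (z : BrokenH2 𝒯) :
    ‖toL2 z‖ ^ 2 = ∑ j, ∫ x in 𝒯.left j..𝒯.right j, (z j).val x ^ 2 := by
  rw [← real_inner_self_eq_norm_sq, toL2, inner_glueL2]
  simp_rw [sq]

theorem norm_secondDeriv_sq (z : BrokenH2 𝒯) :
    ‖secondDeriv z‖ ^ 2 = ∑ j, ∫ x in 𝒯.left j..𝒯.right j, (z j).d2 x ^ 2 := by
  rw [← real_inner_self_eq_norm_sq, secondDeriv, inner_glueL2]
  simp_rw [sq]

theorem norm_hermite_sq (q : TraceData n) :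
    ‖toL2 (hermite 𝒯 q)‖ ^ 2 + ‖secondDeriv (hermite 𝒯 q)‖ ^ 2
      = ∑ j, elemNormSq (𝒯.h j) (q j) := by
  rw [norm_toL2_sq, norm_secondDeriv_sq, ← Finset.sum_add_distrib]
  exact Finset.sum_congr rfl fun j _ => H2.integral_hermite_sq (𝒯.left_lt_right j) (q j)

theorem sum_elemNormSq_brokenTrace_le (z : BrokenH2 𝒯) :
    ∑ j, elemNormSq (𝒯.h j) (brokenTrace 𝒯 z j)
      ≤ 2 * ‖toL2 z‖ ^ 2 + 3 * ‖secondDeriv z‖ ^ 2 := by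
  rw [norm_toL2_sq, norm_secondDeriv_sq, Finset.mul_sum, Finset.mul_sum,
    ← Finset.sum_add_distrib]
  exact Finset.sum_le_sum fun j _ =>
    H2.elemNormSq_trace_le (𝒯.left_lt_right j) (𝒯.h_le_one j) (z j)

end BrokenH2

open BrokenH2

variable {n : ℕ} {𝒯 : Mesh n}

/-- The radicand in the trace norm is nonnegative because it is a sum of squared L₂ norms of the
Hermite lifting; all later estimates use the norm in this form. -/
theorem traceNorm_sq (q : TraceData n × TraceData n) :
    traceNorm 𝒯 q ^ 2 = ‖toL2 (hermite 𝒯 q.1)‖ ^ 2 + ‖secondDeriv (hermite 𝒯 q.1)‖ ^ 2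
      + (‖toL2 (hermite 𝒯 q.2)‖ ^ 2 + ‖secondDeriv (hermite 𝒯 q.2)‖ ^ 2) := by
  have h : ∑ j : Fin n, (elemNormSq (𝒯.h j) (q.1 j) + elemNormSq (𝒯.h j) (q.2 j))
      = ‖toL2 (hermite 𝒯 q.1)‖ ^ 2 + ‖secondDeriv (hermite 𝒯 q.1)‖ ^ 2
      + (‖toL2 (hermite 𝒯 q.2)‖ ^ 2 + ‖secondDeriv (hermite 𝒯 q.2)‖ ^ 2) := by
    rw [norm_hermite_sq, norm_hermite_sq, Finset.sum_add_distrib]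
  rw [traceNorm, h, Real.sq_sqrt (by positivity)]

theorem traceNorm_nonneg (q : TraceData n × TraceData n) : 0 ≤ traceNorm 𝒯 q := Real.sqrt_nonneg _

/-- The Hilbert space in which the test space is embedded. -/
abbrev TestHilbert : Type := PiLp 2 fun _ : Fin 4 => L2I

/-- The isometric embedding `(z, W) ↦ (z, z'', W, W'')` of the test space. -/
def embed (v : TestSpace 𝒯) : TestHilbert :=
  WithLp.toLp 2 ![toL2 v.1, secondDeriv v.1, toL2 v.2, secondDeriv v.2]

theorem inner_embed (e : TestHilbert) (v : TestSpace 𝒯) :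
    inner ℝ e (embed v) = inner ℝ (e 0) (toL2 v.1) + inner ℝ (e 1) (secondDeriv v.1)
      + inner ℝ (e 2) (toL2 v.2) + inner ℝ (e 3) (secondDeriv v.2) := by
  rw [PiLp.inner_apply, Fin.sum_univ_four]
  rfl

theorem testInner_eq (v w : TestSpace 𝒯) : testInner 𝒯 v w = inner ℝ (embed v) (embed w) := by
  rw [inner_embed]
  change _ = inner ℝ (toL2 v.1) (toL2 w.1) + inner ℝ (secondDeriv v.1) (secondDeriv w.1)
    + inner ℝ (toL2 v.2) (toL2 w.2) + inner ℝ (secondDeriv v.2) (secondDeriv w.2)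
  simp only [toL2, secondDeriv, inner_glueL2, testInner, Finset.sum_add_distrib]

/-- Projection onto the range of `embed`. The test space couples neither the elements nor the two
components, so the representative is assembled from the Riesz theorem on single elements. -/
theorem exists_embed_inner_eq (𝒯 : Mesh n) (e : TestHilbert) :
    ∃ v : TestSpace 𝒯, ∀ w : TestSpace 𝒯, inner ℝ (embed v) (embed w) = inner ℝ e (embed w) := by
  have key : ∀ g k : L2I, ∃ R : BrokenH2 𝒯, ∀ z : BrokenH2 𝒯,
      inner ℝ (toL2 R) (toL2 z) + inner ℝ (secondDeriv R) (secondDeriv z)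
        = inner ℝ g (toL2 z) + inner ℝ k (secondDeriv z) := by
    intro g k
    choose R hR using fun j => exists_riesz (𝒯.left_lt_right j)
      (SqInt.mono (Lp.memLp g) (𝒯.left_nonneg j) (𝒯.right_le_one j))
      (SqInt.mono (Lp.memLp k) (𝒯.left_nonneg j) (𝒯.right_le_one j))
    refine ⟨R, fun z => ?_⟩
    rw [toL2, secondDeriv, toL2, secondDeriv, inner_glueL2, inner_glueL2, inner_glueL2_right,
      inner_glueL2_right, ← Finset.sum_add_distrib, ← Finset.sum_add_distrib]
    exact Finset.sum_congr rfl fun j _ => hR j (z j)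
  obtain ⟨R, hR⟩ := key (e 0) (e 1)
  obtain ⟨S, hS⟩ := key (e 2) (e 3)
  refine ⟨(R, S), fun w => ?_⟩
  rw [inner_embed, inner_embed]
  have h1 := hR w.1
  have h2 := hS w.2
  change inner ℝ (toL2 R) (toL2 w.1) + inner ℝ (secondDeriv R) (secondDeriv w.1)
    + inner ℝ (toL2 S) (toL2 w.2) + inner ℝ (secondDeriv S) (secondDeriv w.2) = _
  linarith

/-- Three applications of Green's formula on each element. Any piecewise H² lifting of the traces
may be used: the Hermite lifting gives continuity, functions in H²(I) give the inf-sup condition and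
existence. -/
theorem pairing_brokenTrace (t : ℝ) (U N : BrokenH2 𝒯) (v : TestSpace 𝒯) :
    pairing 𝒯 t (brokenTrace 𝒯 U, brokenTrace 𝒯 N) v
      = inner ℝ (secondDeriv U) (toL2 v.2) - inner ℝ (toL2 U) (secondDeriv v.2)
        + (inner ℝ (secondDeriv N) (toL2 v.1) - inner ℝ (toL2 N) (secondDeriv v.1))
        - t ^ 2 * (inner ℝ (secondDeriv N) (toL2 v.2) - inner ℝ (toL2 N) (secondDeriv v.2)) := by
  simp only [toL2, secondDeriv, inner_glueL2, ← Finset.sum_sub_distrib, ← Finset.sum_add_distrib,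
    Finset.mul_sum, pairing]
  refine Finset.sum_congr rfl fun j _ => ?_
  have h := 𝒯.left_lt_right j
  rw [H2.green h, H2.green h, H2.green h]
  simp [brokenTrace]
  ring

theorem bForm_eq (t : ℝ) (x : Triple n) (v : TestSpace 𝒯) :
    bForm 𝒯 t x v = inner ℝ x.1 (secondDeriv v.2)
      + (inner ℝ x.2.1 (toL2 v.2) + inner ℝ x.2.1 (secondDeriv v.1)
        - t ^ 2 * inner ℝ x.2.1 (secondDeriv v.2)) + pairing 𝒯 t x.2.2 v := by
  simp only [toL2, secondDeriv, inner_glueL2_right, bForm, ← Finset.sum_sub_distrib,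
    ← Finset.sum_add_distrib, Finset.mul_sum]
  refine congrArg (· + pairing 𝒯 t x.2.2 v) ?_
  refine Finset.sum_congr rfl fun j _ => ?_
  congr 1
  have h := (𝒯.left_lt_right j).le
  have hM : SqInt (𝒯.left j) (𝒯.right j) x.2.1 :=
    SqInt.mono (Lp.memLp x.2.1) (𝒯.left_nonneg j) (𝒯.right_le_one j)
  have i1 := hM.mul_intervalIntegrable (v.2 j).sqInt_val h
  have i2 := hM.mul_intervalIntegrable (v.1 j).memLp_d2 h
  have i3 := hM.mul_intervalIntegrable (v.2 j).memLp_d2 h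
  rw [← intervalIntegral.integral_const_mul, ← intervalIntegral.integral_add i1 i2,
    ← intervalIntegral.integral_sub (i1.add i2) (i3.const_mul _)]
  congr 1
  funext s
  ring

theorem load_eq (f : L2I) (v : TestSpace 𝒯) : load 𝒯 f v = -inner ℝ f (toL2 v.1) := by
  rw [load, toL2, inner_glueL2_right]

theorem pairing_lin (t : ℝ) (q r : TraceData n × TraceData n) (c : ℝ) (v : TestSpace 𝒯) :
    pairing 𝒯 t (q + c • r) v = pairing 𝒯 t q v + c * pairing 𝒯 t r v := by
  simp only [pairing, Finset.mul_sum, ← Finset.sum_add_distrib]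
  refine Finset.sum_congr rfl fun j _ => ?_
  simp
  ring

theorem bForm_lin (t : ℝ) (x y : Triple n) (c : ℝ) (v : TestSpace 𝒯) :
    bForm 𝒯 t (x + c • y) v = bForm 𝒯 t x v + c * bForm 𝒯 t y v := by
  simp only [bForm_eq, Prod.fst_add, Prod.snd_add, Prod.smul_fst, Prod.smul_snd, inner_add_left,
    inner_smul_left, pairing_lin, conj_trivial]
  ring

/-- The size of a trial function. -/
def trialNorm (𝒯 : Mesh n) (x : Triple n) : ℝ := ‖x.1‖ + ‖x.2.1‖ + traceNorm 𝒯 x.2.2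

/-- Continuity of b_t: with the Hermite lifting of the traces, all boundary terms become L₂ products
against z, z'', W, W'', and the coefficients are collected in a vector of L₂ functions. -/
theorem exists_bForm_eq_inner (t : ℝ) (ht : t ∈ Icc (0 : ℝ) 1) (x : Triple n) :
    ∃ e : TestHilbert, ‖e‖ ≤ 4 * trialNorm 𝒯 x ∧
      ∀ v : TestSpace 𝒯, bForm 𝒯 t x v = inner ℝ e (embed v) := by
  set U := hermite 𝒯 x.2.2.1 with hU
  set N := hermite 𝒯 x.2.2.2 with hN
  have hs := traceNorm_sq (𝒯 := 𝒯) x.2.2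
  rw [← hU, ← hN] at hs
  have hτ := traceNorm_nonneg (𝒯 := 𝒯) x.2.2
  set τ := traceNorm 𝒯 x.2.2 with hτdef
  have s1 := sq_nonneg (‖toL2 U‖)
  have s2 := sq_nonneg (‖secondDeriv U‖)
  have s3 := sq_nonneg (‖toL2 N‖)
  have s4 := sq_nonneg (‖secondDeriv N‖)
  have b1 : ‖toL2 U‖ ≤ τ := (abs_le_of_sq_le_sq' (by linarith) hτ).2
  have b2 : ‖secondDeriv U‖ ≤ τ := (abs_le_of_sq_le_sq' (by linarith) hτ).2
  have b3 : ‖toL2 N‖ ≤ τ := (abs_le_of_sq_le_sq' (by linarith) hτ).2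
  have b4 : ‖secondDeriv N‖ ≤ τ := (abs_le_of_sq_le_sq' (by linarith) hτ).2
  have ht2 : ‖t ^ 2‖ ≤ 1 := by
    rw [Real.norm_of_nonneg (sq_nonneg t)]; exact pow_le_one₀ ht.1 ht.2
  have hsm : ∀ y : L2I, ‖t ^ 2 • y‖ ≤ ‖y‖ := fun y => by
    rw [norm_smul]; exact mul_le_of_le_one_left (norm_nonneg _) ht2
  refine ⟨WithLp.toLp 2 ![secondDeriv N, x.2.1 - toL2 N,
    x.2.1 + (secondDeriv U - t ^ 2 • secondDeriv N),
    x.1 - toL2 U - (t ^ 2 • (x.2.1 - toL2 N))], ?_, fun v => ?_⟩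
  · have hN0 : 0 ≤ trialNorm 𝒯 x := by unfold trialNorm; positivity
    refine abs_le_of_sq_le_sq' (?_ : _ ^ 2 ≤ _) (by positivity) |>.2
    rw [PiLp.norm_sq_eq_of_L2, Fin.sum_univ_four]
    -- Each of the four components is at most twice the trial norm; four squares of this size give
    -- the constant 4.
    have c : ∀ y : L2I, ‖y‖ ≤ 2 * trialNorm 𝒯 x → ‖y‖ ^ 2 ≤ 4 * trialNorm 𝒯 x ^ 2 := by
      intro y hy
      nlinarith [norm_nonneg y]
    have hu := norm_nonneg x.1
    have hM := norm_nonneg x.2.1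
    have e1 : ‖x.2.1 - toL2 N‖ ≤ ‖x.2.1‖ + τ := (norm_sub_le _ _).trans (by linarith)
    have d1 := c (secondDeriv N) (by unfold trialNorm; linarith)
    have d2 := c (x.2.1 - toL2 N) (by unfold trialNorm; linarith)
    have d3 := c (x.2.1 + (secondDeriv U - t ^ 2 • secondDeriv N)) (by
      unfold trialNorm
      linarith [norm_add_le x.2.1 (secondDeriv U - t ^ 2 • secondDeriv N),
        norm_sub_le (secondDeriv U) (t ^ 2 • secondDeriv N), hsm (secondDeriv N)])
    have d4 := c (x.1 - toL2 U - (t ^ 2 • (x.2.1 - toL2 N))) (by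
      unfold trialNorm
      linarith [norm_sub_le (x.1 - toL2 U) (t ^ 2 • (x.2.1 - toL2 N)),
        norm_sub_le x.1 (toL2 U), hsm (x.2.1 - toL2 N)])
    change ‖secondDeriv N‖ ^ 2 + ‖x.2.1 - toL2 N‖ ^ 2
      + ‖x.2.1 + (secondDeriv U - t ^ 2 • secondDeriv N)‖ ^ 2
      + ‖x.1 - toL2 U - (t ^ 2 • (x.2.1 - toL2 N))‖ ^ 2 ≤ _
    linarith
  · have hp := pairing_brokenTrace t U N v
    rw [hU, hN, brokenTrace_hermite, brokenTrace_hermite, ← hU, ← hN] at hp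
    rw [bForm_eq, inner_embed]
    change _ = inner ℝ (secondDeriv N) (toL2 v.1) + inner ℝ (x.2.1 - toL2 N) (secondDeriv v.1)
      + inner ℝ (x.2.1 + (secondDeriv U - t ^ 2 • secondDeriv N)) (toL2 v.2)
      + inner ℝ (x.1 - toL2 U - (t ^ 2 • (x.2.1 - toL2 N))) (secondDeriv v.2)
    have : x.2.2 = (x.2.2.1, x.2.2.2) := rfl
    rw [this, hp]
    simp only [inner_sub_left, inner_add_left, inner_smul_left, conj_trivial]
    ring

end

/-! ### Conforming functions, boundary conditions and the energy estimate -/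

section
open BrokenH2

namespace H2

/-- The class in `L₂(I)` of an element of `H²(I)`. -/
def toL2 (v : H2 0 1) : L2I := v.sqInt_val.toLp

/-- The class in `L₂(I)` of the second derivative of an element of `H²(I)`. -/
def secondDeriv (v : H2 0 1) : L2I := MemLp.toLp v.d2 v.memLp_d2

theorem toL2_lin (v w : H2 0 1) (c : ℝ) :
    (lin zero_lt_one v w c).toL2 = v.toL2 + c • w.toL2 := rfl

theorem secondDeriv_lin (v w : H2 0 1) (c : ℝ) :
    (lin zero_lt_one v w c).secondDeriv = v.secondDeriv + c • w.secondDeriv := rfl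

theorem norm_toL2_sq (v : H2 0 1) : ‖v.toL2‖ ^ 2 = ∫ x in (0 : ℝ)..1, v.val x ^ 2 :=
  norm_toLp_sq zero_le_one v.sqInt_val

theorem norm_secondDeriv_sq (v : H2 0 1) :
    ‖v.secondDeriv‖ ^ 2 = ∫ x in (0 : ℝ)..1, v.d2 x ^ 2 :=
  norm_toLp_sq zero_le_one v.memLp_d2

/-- The element-wise restrictions of an element of `H²(I)`. -/
def toBroken {n : ℕ} (𝒯 : Mesh n) (v : H2 0 1) : BrokenH2 𝒯 := fun j =>
  v.restrict zero_lt_one (𝒯.left_nonneg j) (𝒯.left_lt_right j).le (𝒯.right_le_one j)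

variable {n : ℕ} {𝒯 : Mesh n}

theorem brokenTrace_toBroken (v : H2 0 1) : brokenTrace 𝒯 (v.toBroken 𝒯) = trace 𝒯 v := rfl

theorem glueL2_restrict {f : ℝ → ℝ} (hf : SqInt 0 1 f)
    (h : ∀ j, SqInt (𝒯.left j) (𝒯.right j) f) : glueL2 𝒯 (fun _ => f) h = hf.toLp := by
  refine ext_inner_left ℝ fun u => ?_
  rw [inner_glueL2_right, inner_toLp_right zero_le_one, 𝒯.sum_integral_eq]
  exact SqInt.mul_intervalIntegrable (Lp.memLp u) hf zero_le_one

theorem toL2_toBroken (v : H2 0 1) : BrokenH2.toL2 (v.toBroken 𝒯) = v.toL2 :=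
  glueL2_restrict v.sqInt_val _

theorem secondDeriv_toBroken (v : H2 0 1) :
    BrokenH2.secondDeriv (v.toBroken 𝒯) = v.secondDeriv :=
  glueL2_restrict v.memLp_d2 _

end H2

variable {n : ℕ} {𝒯 : Mesh n}

namespace BrokenH2

/-- The zero element. -/
def zero (𝒯 : Mesh n) : BrokenH2 𝒯 := lin (hermite 𝒯 0) (hermite 𝒯 0) (-1)

@[simp] theorem toL2_zero : toL2 (zero 𝒯) = 0 := by simp [zero, toL2_lin]

@[simp] theorem secondDeriv_zero : secondDeriv (zero 𝒯) = 0 := by simp [zero, secondDeriv_lin]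

/-- Element-wise Green's formula. -/
theorem green (U z : BrokenH2 𝒯) :
    inner ℝ (secondDeriv U) (toL2 z) - inner ℝ (toL2 U) (secondDeriv z)
      = ∑ j, (brokenTrace 𝒯 U j 3 * brokenTrace 𝒯 z j 2 - brokenTrace 𝒯 U j 1 * brokenTrace 𝒯 z j 0
        - (brokenTrace 𝒯 U j 2 * brokenTrace 𝒯 z j 3
          - brokenTrace 𝒯 U j 0 * brokenTrace 𝒯 z j 1)) := by
  simp only [toL2, secondDeriv, inner_glueL2, ← Finset.sum_sub_distrib]
  refine Finset.sum_congr rfl fun j _ => ?_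
  rw [H2.green (𝒯.left_lt_right j)]
  rfl

/-- By Green's formula the hypothesis is that the boundary form vanishes against all traces. That
form is nondegenerate, and Hermite interpolants supported on a single element realise every boundary
datum. -/
theorem brokenTrace_eq_zero (U : BrokenH2 𝒯)
    (h : ∀ z : BrokenH2 𝒯,
      inner ℝ (secondDeriv U) (toL2 z) - inner ℝ (toL2 U) (secondDeriv z) = 0) :
    brokenTrace 𝒯 U = 0 := by
  funext j
  have key : ∀ p : Fin 4 → ℝ, brokenTrace 𝒯 U j 3 * p 2 - brokenTrace 𝒯 U j 1 * p 0
      - (brokenTrace 𝒯 U j 2 * p 3 - brokenTrace 𝒯 U j 0 * p 1) = 0 := by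
    intro p
    have h1 := h (hermite 𝒯 (Pi.single j p))
    rw [green, brokenTrace_hermite, Finset.sum_eq_single j] at h1
    · simpa using h1
    · intro i _ hij
      simp [hij]
    · simp
  funext i
  have k0 := key ![1, 0, 0, 0]
  have k1 := key ![0, 1, 0, 0]
  have k2 := key ![0, 0, 1, 0]
  have k3 := key ![0, 0, 0, 1]
  simp at k0 k1 k2 k3
  fin_cases i <;> simp [k0, k1, k2, k3]

end BrokenH2

/-- The Hermite interpolants and their second derivatives vanish in L₂; Green's formula then forces
their traces to vanish. -/
theorem eq_zero_of_traceNorm_eq_zero {q : TraceData n × TraceData n} (h : traceNorm 𝒯 q = 0) :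
    q = 0 := by
  have hs := traceNorm_sq (𝒯 := 𝒯) q
  rw [h] at hs
  have key : ∀ r : TraceData n, ‖toL2 (hermite 𝒯 r)‖ ^ 2 = 0 →
      ‖secondDeriv (hermite 𝒯 r)‖ ^ 2 = 0 → r = 0 := by
    intro r h1 h2
    rw [← brokenTrace_hermite (𝒯 := 𝒯) r]
    apply brokenTrace_eq_zero
    intro z
    rw [norm_eq_zero.1 (pow_eq_zero_iff two_ne_zero |>.1 h1),
      norm_eq_zero.1 (pow_eq_zero_iff two_ne_zero |>.1 h2)]
    simp
  have s1 := sq_nonneg (‖toL2 (hermite 𝒯 q.1)‖)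
  have s2 := sq_nonneg (‖secondDeriv (hermite 𝒯 q.1)‖)
  have s3 := sq_nonneg (‖toL2 (hermite 𝒯 q.2)‖)
  have s4 := sq_nonneg (‖secondDeriv (hermite 𝒯 q.2)‖)
  exact Prod.ext (key q.1 (by linarith) (by linarith)) (key q.2 (by linarith) (by linarith))

/-- A pair of `L₂` functions that satisfies Green's formula with the boundary data of an element
of `H²(I)` on all mesh elements consists of an `H²` function with the same element-wise boundary
data and its second derivative. -/
theorem exists_H2_of_broken_weak (V W : L2I) (N : H2 0 1)
    (h : ∀ z : BrokenH2 𝒯, inner ℝ V (secondDeriv z) - inner ℝ W (toL2 z)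
      = inner ℝ N.toL2 (secondDeriv z) - inner ℝ N.secondDeriv (toL2 z)) :
    ∃ m : H2 0 1, m.toL2 = V ∧ m.secondDeriv = W ∧ trace 𝒯 m = trace 𝒯 N := by
  obtain ⟨m, hm, hm2⟩ := exists_H2_of_weak zero_lt_one (Lp.memLp V) (Lp.memLp W) (by
    intro z hz
    have h1 := h (z.toBroken 𝒯)
    rw [H2.toL2_toBroken, H2.secondDeriv_toBroken] at h1
    have h2 := N.green zero_lt_one z
    rw [hz.1, hz.2.1, hz.2.2.1, hz.2.2.2] at h2
    have e1 : inner ℝ V z.secondDeriv = _ := inner_toLp_right zero_le_one V z.memLp_d2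
    have e2 : inner ℝ W z.toL2 = _ := inner_toLp_right zero_le_one W z.sqInt_val
    have e3 : inner ℝ N.toL2 z.secondDeriv = _ := inner_toLp zero_le_one N.sqInt_val z.memLp_d2
    have e4 : inner ℝ N.secondDeriv z.toL2 = _ := inner_toLp zero_le_one N.memLp_d2 z.sqInt_val
    rw [e1, e2, e3, e4] at h1
    linarith)
  have hmV : m.toL2 = V := by
    rw [H2.toL2, ← Lp.toLp_coeFn V (Lp.memLp V)]
    exact MemLp.toLp_congr _ _ hm
  have hmW : m.secondDeriv = W := by
    rw [H2.secondDeriv, ← Lp.toLp_coeFn W (Lp.memLp W)]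
    exact MemLp.toLp_congr _ _ (by rw [hm2])
  refine ⟨m, hmV, hmW, ?_⟩
  -- Zero-trace test functions on all of I suffice to produce `m`. Broken test functions now show
  -- that `N` and `m` have the same trace on every element.
  let e := H2.lin zero_lt_one N m (-1)
  have he : brokenTrace 𝒯 (e.toBroken 𝒯) = 0 := by
    apply brokenTrace_eq_zero
    intro z
    rw [H2.toL2_toBroken, H2.secondDeriv_toBroken]
    simp only [e, H2.toL2_lin, H2.secondDeriv_lin, hmV, hmW, inner_add_left, inner_smul_left,
      conj_trivial]
    linarith [h z]
  rw [H2.brokenTrace_toBroken] at he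
  funext j i
  have := congrFun (congrFun he j) i
  fin_cases i <;> simp [trace, e] at this ⊢ <;> linarith

/-- The values at 0 and 1 belong to the data of the first and last element; a mesh without elements
would identify the nodes 0 and 1. -/
theorem Mesh.endpoints_eq (𝒯 : Mesh n) {v w : H2 0 1} (h : trace 𝒯 v = trace 𝒯 w) :
    v.val 0 = w.val 0 ∧ v.d1 0 = w.d1 0 ∧ v.val 1 = w.val 1 ∧ v.d1 1 = w.d1 1 := by
  cases n with
  | zero =>
    have h0 := 𝒯.node_zero
    have h1 := 𝒯.node_last
    rw [show Fin.last 0 = 0 from rfl, h0] at h1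
    exact absurd h1 zero_ne_one
  | succ n =>
    have hl : 𝒯.left 0 = 0 := 𝒯.node_zero
    have hr : 𝒯.right (Fin.last n) = 1 := 𝒯.node_last
    have e0 := congrFun (congrFun h 0) 0
    have e1 := congrFun (congrFun h 0) 1
    have e2 := congrFun (congrFun h (Fin.last n)) 2
    have e3 := congrFun (congrFun h (Fin.last n)) 3
    simp only [trace, hl, hr] at e0 e1 e2 e3
    exact ⟨e0, e1, e2, e3⟩

theorem SatisfiesBC.congr {a : BC} {t : ℝ} {u M u' M' : H2 0 1} (h : SatisfiesBC a t u M)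
    (hu : u'.val 0 = u.val 0 ∧ u'.d1 0 = u.d1 0 ∧ u'.val 1 = u.val 1 ∧ u'.d1 1 = u.d1 1)
    (hM : M'.val 0 = M.val 0 ∧ M'.d1 0 = M.d1 0 ∧ M'.val 1 = M.val 1 ∧ M'.d1 1 = M.d1 1) :
    SatisfiesBC a t u' M' := by
  obtain ⟨h1, h2, h3, h4⟩ := hu
  obtain ⟨h5, h6, h7, h8⟩ := hM
  cases a <;> simp only [SatisfiesBC, h1, h2, h3, h4, h5, h6, h7, h8] at h ⊢ <;> exact h

namespace H2

/-- The first-order Taylor remainder at 0 and its derivative vanish there, so Cauchy-Schwarz can be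
applied twice on the unit interval. -/
theorem sq_sub_affine_le (v : H2 0 1) {x : ℝ} (hx : x ∈ Icc (0 : ℝ) 1) :
    (v.val x - v.val 0 - v.d1 0 * x) ^ 2 ≤ ‖v.secondDeriv‖ ^ 2 := by
  let e := lin zero_lt_one v (cubic zero_le_one (v.val 0) (v.d1 0) 0 0) (-1)
  have e0 : e.val 0 = 0 := by simp [e, cubic, ofPrimitive]
  have e1 : e.d1 0 = 0 := by simp [e, cubic, ofPrimitive]
  have e2 : e.d2 = v.d2 := by simp [e, cubic, ofPrimitive]
  have i1 : ∫ x in (0 : ℝ)..1, e.d1 x ^ 2 ≤ (1 - 0) * ((1 - 0) * ∫ x in (0 : ℝ)..1, e.d2 x ^ 2) :=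
    integral_sq_le_of_abs_le zero_le_one e.continuousOn_d1 fun x hx => by
      simpa [e1] using (e.isPrimitive_d1 zero_lt_one).sq_sub_le e.memLp_d2 hx
  have i0 := (e.isPrimitive_val zero_lt_one).sq_sub_le e.sqInt_d1 hx
  rw [e0, sub_zero] at i0
  rw [e2] at i1
  have e3 : e.val x = v.val x - v.val 0 - v.d1 0 * x := by
    simp [e, cubic, ofPrimitive]; ring
  rw [e3] at i0
  rw [norm_secondDeriv_sq]
  linarith

theorem norm_toL2_le_of_abs_le (v : H2 0 1) {C : ℝ} (hC : 0 ≤ C)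
    (h : ∀ x ∈ Icc (0 : ℝ) 1, |v.val x| ≤ C) : ‖v.toL2‖ ≤ C := by
  have := integral_sq_le_of_abs_le zero_le_one v.continuousOn_val (C := C ^ 2) fun x hx =>
    sq_le_sq' (abs_le.1 (h x hx)).1 (abs_le.1 (h x hx)).2
  rw [← norm_toL2_sq] at this
  exact (abs_le_of_sq_le_sq' (by linarith) hC).2

/-- A trace inequality. -/
theorem abs_val_zero_le (v : H2 0 1) : |v.val 0| ≤ 3 * (‖v.toL2‖ + ‖v.secondDeriv‖) := by
  let l : H2 0 1 := cubic zero_le_one (v.val 0) (v.d1 0) 0 0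
  have hl : ∀ x, l.val x = v.val 0 + v.d1 0 * x := fun x => by simp [l, cubic, ofPrimitive]
  let e := lin zero_lt_one v l (-1)
  have h1 : ‖e.toL2‖ ≤ ‖v.secondDeriv‖ := by
    refine e.norm_toL2_le_of_abs_le (norm_nonneg _) fun x hx => ?_
    have : e.val x = v.val x - v.val 0 - v.d1 0 * x := by simp only [e, lin_val, hl]; ring
    rw [this]
    exact abs_le_of_sq_le_sq (v.sq_sub_affine_le hx) (norm_nonneg _)
  have h2 : ‖l.toL2‖ ≤ ‖v.toL2‖ + ‖v.secondDeriv‖ := by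
    have : l.toL2 = v.toL2 - e.toL2 := by
      simp only [e, toL2_lin]; module
    rw [this]
    exact (norm_sub_le _ _).trans (by linarith)
  have h3 : ‖l.toL2‖ ^ 2 = v.val 0 ^ 2 + v.val 0 * v.d1 0 + v.d1 0 ^ 2 / 3 := by
    rw [norm_toL2_sq]
    have := integral_poly_six 0 1 (v.val 0 ^ 2) (2 * v.val 0 * v.d1 0) (v.d1 0 ^ 2) 0 0 0 0
    simp only [sub_zero, zero_mul, add_zero] at this
    have e : ∀ x, l.val x ^ 2 = v.val 0 ^ 2 + 2 * v.val 0 * v.d1 0 * x + v.d1 0 ^ 2 * x ^ 2 :=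
      fun x => by rw [hl]; ring
    simp_rw [e]
    rw [this]
    ring
  -- Completing the square: v₀² + v₀d + d²/3 = ((3v₀ + 2d)² + 3v₀²)/12 ≥ v₀²/4.
  have h4 : (v.val 0) ^ 2 ≤ (2 * ‖l.toL2‖) ^ 2 := by
    nlinarith [sq_nonneg (3 * v.val 0 + 2 * v.d1 0)]
  have h5 := abs_le_of_sq_le_sq h4 (by positivity)
  linarith [norm_nonneg v.toL2, norm_nonneg v.secondDeriv]

end H2

/-- With u = p + t²m, a clamped end means p' = 0 and p = -t²m, a supported end m = p = 0, and a free
end m = m' = 0. In each case p'm - pm' reduces to t²mm', which is what gives the energy estimate its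
sign. -/
theorem SatisfiesBC.boundary_identity {a : BC} {t : ℝ} {m p : H2 0 1}
    (h : SatisfiesBC a t (H2.lin zero_lt_one p m (t ^ 2)) m) :
    p.d1 1 * m.val 1 - p.d1 0 * m.val 0 - (p.val 1 * m.d1 1 - p.val 0 * m.d1 0)
      = t ^ 2 * (m.val 1 * m.d1 1 - m.val 0 * m.d1 0) := by
  cases a <;> simp only [SatisfiesBC, H2.lin_val, H2.lin_d1] at h <;>
    obtain ⟨h1, h2, h3, h4⟩ := h
  · have e1 : p.d1 0 = 0 := by linarith
    have e2 : p.d1 1 = 0 := by linarith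
    rw [e1, e2]
    linear_combination m.d1 0 * h1 - m.d1 1 * h3
  · have e1 : p.d1 0 = 0 := by linarith
    rw [e1, h4]
    rw [h4] at h3
    linear_combination m.d1 0 * h1 - m.d1 1 * h3
  · have e1 : p.d1 0 = 0 := by linarith
    rw [e1, h3, h4]
    linear_combination m.d1 0 * h1
  · rw [h2, h4]
    rw [h2] at h1
    rw [h4] at h3
    linear_combination m.d1 0 * h1 - m.d1 1 * h3

/-- Taylor expansion at 0. If the left end is clamped, p'(0) = 0 and p(0) = -t²m(0); if both ends
are supported, p vanishes at both and the slope at 0 is bounded by the remainder at 1. The value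
m(0) is left for the trace inequality. -/
theorem SatisfiesBC.abs_val_le {a : BC} {t : ℝ} (ht : t ∈ Icc (0 : ℝ) 1) {m p : H2 0 1}
    (h : SatisfiesBC a t (H2.lin zero_lt_one p m (t ^ 2)) m) {x : ℝ} (hx : x ∈ Icc (0 : ℝ) 1) :
    |p.val x| ≤ 2 * ‖p.secondDeriv‖ + |m.val 0| := by
  have k1 := abs_le.1 (abs_le_of_sq_le_sq (p.sq_sub_affine_le hx) (norm_nonneg _))
  have k2 := abs_le.1 (abs_le_of_sq_le_sq
    (p.sq_sub_affine_le (right_mem_Icc.2 zero_le_one)) (norm_nonneg _))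
  have hn := norm_nonneg p.secondDeriv
  have key : |p.val 0| ≤ |m.val 0| → p.d1 0 = 0 →
      |p.val x| ≤ 2 * ‖p.secondDeriv‖ + |m.val 0| := by
    intro h0 h1
    rw [h1] at k1
    have := abs_le.1 h0
    rw [abs_le]
    constructor <;> linarith
  have hbd : p.val 0 + t ^ 2 * m.val 0 = 0 → |p.val 0| ≤ |m.val 0| := by
    intro h0
    have : p.val 0 = -(t ^ 2 * m.val 0) := by linarith
    rw [this, abs_neg, abs_mul, abs_of_nonneg (sq_nonneg t)]
    exact mul_le_of_le_one_left (abs_nonneg _) (pow_le_one₀ ht.1 ht.2)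
  cases a <;> simp only [SatisfiesBC, H2.lin_val, H2.lin_d1] at h <;>
    obtain ⟨h1, h2, h3, h4⟩ := h
  · exact key (hbd h1) (by linarith)
  · exact key (hbd h1) (by linarith)
  · exact key (hbd h1) (by linarith)
  · have e0 : p.val 0 = 0 := by rw [h2] at h1; linarith
    have e1 : p.val 1 = 0 := by rw [h4] at h3; linarith
    rw [e0, e1] at k2
    rw [e0] at k1
    have h5 : |p.d1 0 * x| ≤ ‖p.secondDeriv‖ := by
      rw [abs_mul, abs_of_nonneg hx.1]
      have : |p.d1 0| ≤ ‖p.secondDeriv‖ := abs_le.2 ⟨by linarith, by linarith⟩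
      nlinarith [abs_nonneg (p.d1 0), hx.1, hx.2]
    have := abs_le.1 h5
    have := abs_nonneg (m.val 0)
    rw [abs_le]
    constructor <;> linarith

/-- The energy estimate, uniform in the thickness `t`. -/
theorem SatisfiesBC.norm_le {a : BC} {t : ℝ} (ht : t ∈ Icc (0 : ℝ) 1) {m p : H2 0 1}
    (h : SatisfiesBC a t (H2.lin zero_lt_one p m (t ^ 2)) m) {s : ℝ}
    (hm : ‖m.secondDeriv‖ ≤ s) (hp : ‖p.secondDeriv + m.toL2‖ ≤ s) :
    ‖m.toL2‖ ≤ 8 * s ∧ ‖p.toL2‖ ≤ 45 * s ∧ ‖p.secondDeriv‖ ≤ 9 * s := by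
  set F := p.secondDeriv + m.toL2 with hF
  have hs : 0 ≤ s := (norm_nonneg _).trans hm
  have hm0 := norm_nonneg m.toL2
  have hp2 : ‖p.secondDeriv‖ ≤ s + ‖m.toL2‖ := by
    have : p.secondDeriv = F - m.toL2 := by rw [hF]; abel
    rw [this]
    exact (norm_sub_le _ _).trans (by linarith)
  have hp0 : ‖p.toL2‖ ≤ 5 * s + 5 * ‖m.toL2‖ :=
    p.norm_toL2_le_of_abs_le (by positivity) fun x hx =>
      (h.abs_val_le ht hx).trans (by linarith [m.abs_val_zero_le])
  have g1 := p.green zero_lt_one m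
  rw [h.boundary_identity] at g1
  have g2 := (m.isPrimitive_d1 zero_lt_one).integral_mul_eq (m.isPrimitive_val zero_lt_one)
    zero_le_one
  have e1 : inner ℝ p.secondDeriv m.toL2 = _ := inner_toLp zero_le_one p.memLp_d2 m.sqInt_val
  have e2 : inner ℝ p.toL2 m.secondDeriv = _ := inner_toLp zero_le_one p.sqInt_val m.memLp_d2
  have e3 : inner ℝ m.secondDeriv m.toL2 = _ := inner_toLp zero_le_one m.memLp_d2 m.sqInt_val
  have e4 : 0 ≤ ∫ x in (0 : ℝ)..1, m.d1 x * m.d1 x :=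
    intervalIntegral.integral_nonneg zero_le_one fun _ _ => mul_self_nonneg _
  rw [← e1, ← e2] at g1
  rw [← e3] at g2
  have e5 : inner ℝ p.secondDeriv m.toL2 = inner ℝ F m.toL2 - ‖m.toL2‖ ^ 2 := by
    rw [hF, inner_add_left, real_inner_self_eq_norm_sq]; ring
  have c1 : inner ℝ F m.toL2 ≤ s * ‖m.toL2‖ :=
    (real_inner_le_norm _ _).trans (by gcongr)
  have c2 : -inner ℝ p.toL2 m.secondDeriv ≤ (5 * s + 5 * ‖m.toL2‖) * s := by
    refine (neg_le_abs _).trans ((abs_real_inner_le_norm _ _).trans ?_)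
    gcongr
  have c3 : -inner ℝ m.secondDeriv m.toL2 ≤ s * ‖m.toL2‖ := by
    refine (neg_le_abs _).trans ((abs_real_inner_le_norm _ _).trans ?_)
    gcongr
  have t0 : 0 ≤ t ^ 2 := sq_nonneg t
  have t1 : t ^ 2 ≤ 1 := pow_le_one₀ ht.1 ht.2
  have c4 : -(t ^ 2 * inner ℝ m.secondDeriv m.toL2) ≤ s * ‖m.toL2‖ := by
    have : 0 ≤ s * ‖m.toL2‖ := by positivity
    nlinarith
  -- The only term involving m' enters with a good sign and is discarded; nothing is ever divided by
  -- t.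
  have c5 : 0 ≤ t ^ 2 * ∫ x in (0 : ℝ)..1, m.d1 x * m.d1 x := mul_nonneg t0 e4
  have c6 : ‖m.toL2‖ ^ 2 ≤ 7 * s * ‖m.toL2‖ + 5 * s ^ 2 := by
    have g3 : t ^ 2 * (m.val 1 * m.d1 1 - m.val 0 * m.d1 0)
        = t ^ 2 * inner ℝ m.secondDeriv m.toL2
          + t ^ 2 * ∫ x in (0 : ℝ)..1, m.d1 x * m.d1 x := by
      rw [g2]; ring
    rw [g3, e5] at g1
    nlinarith
  -- If ‖m‖ > 8s, then `c6` would give s‖m‖ < 5s², which is impossible.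
  have c7 : ‖m.toL2‖ ≤ 8 * s := by
    by_contra hc
    push Not at hc
    nlinarith
  exact ⟨c7, by linarith, by linarith⟩

/-- The boundary conditions can be attained by adding a solution of the homogeneous equations. -/
theorem exists_homogeneous_satisfiesBC (a : BC) (t : ℝ) (m p : H2 0 1) :
    ∃ c₀ c₁ c₂ c₃ : ℝ, SatisfiesBC a t
      (H2.lin zero_lt_one
        (H2.lin zero_lt_one p (H2.cubic zero_le_one c₂ c₃ (-c₀ / 2) (-c₁ / 6)) 1)
        (H2.lin zero_lt_one m (H2.cubic zero_le_one c₀ c₁ 0 0) 1) (t ^ 2))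
      (H2.lin zero_lt_one m (H2.cubic zero_le_one c₀ c₁ 0 0) 1) := by
  -- The correction has m affine with coefficients c₀, c₁ and p cubic with p'' = -m, so four
  -- parameters meet four conditions whose negated residuals are called r₁, …, r₄. The last pivots
  -- are t² + 1/12 and t² + 1/3 for `cc` and `cs`; the other two cases need no division by a
  -- t-dependent quantity.
  have hA : t ^ 2 + 1 / 12 ≠ 0 := by positivity
  have hB : t ^ 2 + 1 / 3 ≠ 0 := by positivity
  cases a with
  | cc =>
    let r₁ := -(p.val 0 + t ^ 2 * m.val 0)
    let r₂ := -p.d1 0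
    let r₃ := -(p.val 1 + t ^ 2 * m.val 1)
    let r₄ := -p.d1 1
    obtain ⟨c₁, hc₁⟩ : ∃ c, c * (t ^ 2 + 1 / 12) = r₃ - r₁ - r₂ + (r₂ - r₄) / 2 :=
      ⟨_, div_mul_cancel₀ _ hA⟩
    refine ⟨r₂ - r₄ - c₁ / 2, c₁, r₁ - t ^ 2 * (r₂ - r₄ - c₁ / 2), r₂, ?_⟩
    simp only [SatisfiesBC, H2.lin_val, H2.lin_d1, H2.cubic, H2.ofPrimitive]
    simp only [r₁, r₂, r₃, r₄] at hc₁ ⊢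
    refine ⟨by ring, by ring, ?_, by ring⟩
    linear_combination hc₁
  | cs =>
    let r₁ := -(p.val 0 + t ^ 2 * m.val 0)
    let r₂ := -p.d1 0
    let r₃ := -(p.val 1 + t ^ 2 * m.val 1)
    let r₄ := -m.val 1
    obtain ⟨c₀, hc₀⟩ : ∃ c, c * (t ^ 2 + 1 / 3) = -(r₃ - r₁ - r₂ + r₄ / 6 - t ^ 2 * r₄) :=
      ⟨_, div_mul_cancel₀ _ hB⟩
    refine ⟨c₀, r₄ - c₀, r₁ - t ^ 2 * c₀, r₂, ?_⟩
    simp only [SatisfiesBC, H2.lin_val, H2.lin_d1, H2.cubic, H2.ofPrimitive]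
    simp only [r₁, r₂, r₃, r₄] at hc₀ ⊢
    refine ⟨by ring, by ring, ?_, by ring⟩
    linear_combination -hc₀
  | cf =>
    let r₁ := -(p.val 0 + t ^ 2 * m.val 0)
    let r₂ := -p.d1 0
    let r₃ := -m.val 1
    let r₄ := -m.d1 1
    refine ⟨r₃ - r₄, r₄, r₁ - t ^ 2 * (r₃ - r₄), r₂, ?_⟩
    simp only [SatisfiesBC, H2.lin_val, H2.lin_d1, H2.cubic, H2.ofPrimitive, r₁, r₂, r₃, r₄]
    refine ⟨by ring, by ring, by ring, by ring⟩
  | ss =>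
    let r₁ := -(p.val 0 + t ^ 2 * m.val 0)
    let r₂ := -m.val 0
    let r₃ := -(p.val 1 + t ^ 2 * m.val 1)
    let r₄ := -m.val 1
    refine ⟨r₂, r₄ - r₂, r₁ - t ^ 2 * r₂,
      r₃ - t ^ 2 * r₄ - (r₁ - t ^ 2 * r₂) + r₂ / 2 + (r₄ - r₂) / 6, ?_⟩
    simp only [SatisfiesBC, H2.lin_val, H2.cubic, H2.ofPrimitive, r₁, r₂, r₃, r₄]
    refine ⟨by ring, by ring, by ring, by ring⟩

end

/-! ### Inf-sup condition, existence of solutions and the trial-to-test operator -/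

section
open BrokenH2

variable {n : ℕ} {𝒯 : Mesh n}

theorem eq_zero_of_trialNorm_nonpos {x : Triple n} (h : trialNorm 𝒯 x ≤ 0) : x = 0 := by
  have h1 := norm_nonneg x.1
  have h2 := norm_nonneg x.2.1
  have h3 := traceNorm_nonneg (𝒯 := 𝒯) x.2.2
  unfold trialNorm at h
  exact Prod.ext (norm_le_zero_iff.1 (by linarith)) (Prod.ext (norm_le_zero_iff.1 (by linarith))
    (eq_zero_of_traceNorm_eq_zero (𝒯 := 𝒯) (by linarith)))

theorem SatisfiesBC.lin {a : BC} {t : ℝ} {u M u' M' : H2 0 1} (h : SatisfiesBC a t u M)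
    (h' : SatisfiesBC a t u' M') (c : ℝ) :
    SatisfiesBC a t (H2.lin zero_lt_one u u' c) (H2.lin zero_lt_one M M' c) := by
  cases a <;> simp only [SatisfiesBC, H2.lin_val, H2.lin_d1] at h h' ⊢ <;>
    obtain ⟨h1, h2, h3, h4⟩ := h <;> obtain ⟨h5, h6, h7, h8⟩ := h' <;>
    refine ⟨?_, ?_, ?_, ?_⟩
  all_goals first
    | linear_combination h1 + c * h5
    | linear_combination h2 + c * h6
    | linear_combination h3 + c * h7
    | linear_combination h4 + c * h8

theorem trace_lin (u v : H2 0 1) (c : ℝ) :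
    trace 𝒯 (H2.lin zero_lt_one u v c) = trace 𝒯 u + c • trace 𝒯 v := by
  funext j i
  fin_cases i <;> simp [trace]

theorem traceSpace_lin {a : BC} {t : ℝ} {q r : TraceData n × TraceData n}
    (hq : q ∈ traceSpace 𝒯 a t) (hr : r ∈ traceSpace 𝒯 a t) (c : ℝ) :
    q + c • r ∈ traceSpace 𝒯 a t := by
  obtain ⟨u, M, h, rfl⟩ := hq
  obtain ⟨u', M', h', rfl⟩ := hr
  refine ⟨_, _, h.lin h' c, ?_⟩
  rw [trace_lin, trace_lin]
  rfl

theorem trialSpace_lin {a : BC} {t : ℝ} {x y : Triple n}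
    (hx : x ∈ trialSpace 𝒯 a t) (hy : y ∈ trialSpace 𝒯 a t) (c : ℝ) :
    x + c • y ∈ trialSpace 𝒯 a t :=
  traceSpace_lin hx hy c

theorem trialSpace_sub {a : BC} {t : ℝ} {x y : Triple n}
    (hx : x ∈ trialSpace 𝒯 a t) (hy : y ∈ trialSpace 𝒯 a t) : x - y ∈ trialSpace 𝒯 a t := by
  have := trialSpace_lin hx hy (-1)
  rwa [neg_one_smul, ← sub_eq_add_neg] at this

theorem pairing_trace (t : ℝ) (u M : H2 0 1) (v : TestSpace 𝒯) :
    pairing 𝒯 t (trace 𝒯 u, trace 𝒯 M) v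
      = inner ℝ u.secondDeriv (toL2 v.2) - inner ℝ u.toL2 (secondDeriv v.2)
        + (inner ℝ M.secondDeriv (toL2 v.1) - inner ℝ M.toL2 (secondDeriv v.1))
        - t ^ 2 * (inner ℝ M.secondDeriv (toL2 v.2) - inner ℝ M.toL2 (secondDeriv v.2)) := by
  have := pairing_brokenTrace t (u.toBroken 𝒯) (M.toBroken 𝒯) v
  rwa [H2.brokenTrace_toBroken, H2.brokenTrace_toBroken, H2.toL2_toBroken, H2.toL2_toBroken,
    H2.secondDeriv_toBroken, H2.secondDeriv_toBroken] at this

theorem norm_components_le (R : TestSpace 𝒯) :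
    ‖toL2 R.1‖ ≤ ‖embed R‖ ∧ ‖secondDeriv R.1‖ ≤ ‖embed R‖ ∧ ‖toL2 R.2‖ ≤ ‖embed R‖ ∧
      ‖secondDeriv R.2‖ ≤ ‖embed R‖ :=
  ⟨PiLp.norm_apply_le (embed R) 0, PiLp.norm_apply_le (embed R) 1, PiLp.norm_apply_le (embed R) 2,
    PiLp.norm_apply_le (embed R) 3⟩

theorem traceNorm_trace_sq_le (u M : H2 0 1) :
    traceNorm 𝒯 (trace 𝒯 u, trace 𝒯 M) ^ 2
      ≤ 2 * ‖u.toL2‖ ^ 2 + 3 * ‖u.secondDeriv‖ ^ 2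
        + (2 * ‖M.toL2‖ ^ 2 + 3 * ‖M.secondDeriv‖ ^ 2) := by
  have h1 := sum_elemNormSq_brokenTrace_le (u.toBroken 𝒯)
  have h2 := sum_elemNormSq_brokenTrace_le (M.toBroken 𝒯)
  rw [H2.brokenTrace_toBroken, H2.toL2_toBroken, H2.secondDeriv_toBroken] at h1 h2
  rw [traceNorm_sq, norm_hermite_sq, norm_hermite_sq]
  exact add_le_add h1 h2

/-- The inf-sup condition, uniform in the mesh and the thickness. -/
theorem trialNorm_le_norm_embed {a : BC} {t : ℝ} (ht : t ∈ Icc (0 : ℝ) 1) {x : Triple n}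
    (hx : x ∈ trialSpace 𝒯 a t) {R : TestSpace 𝒯}
    (hR : ∀ v : TestSpace 𝒯, inner ℝ (embed R) (embed v) = bForm 𝒯 t x v) :
    trialNorm 𝒯 x ≤ 325 * ‖embed R‖ := by
  obtain ⟨u₀, M₀, hBC, hq⟩ := hx
  obtain ⟨n1, n2, n3, n4⟩ := norm_components_le R
  set η := ‖embed R‖ with hη
  have hη0 : 0 ≤ η := norm_nonneg _
  have key : ∀ v : TestSpace 𝒯, inner ℝ (toL2 R.1) (toL2 v.1)
      + inner ℝ (secondDeriv R.1) (secondDeriv v.1) + inner ℝ (toL2 R.2) (toL2 v.2)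
      + inner ℝ (secondDeriv R.2) (secondDeriv v.2)
      = inner ℝ x.1 (secondDeriv v.2)
        + (inner ℝ x.2.1 (toL2 v.2) + inner ℝ x.2.1 (secondDeriv v.1)
          - t ^ 2 * inner ℝ x.2.1 (secondDeriv v.2)) + pairing 𝒯 t (trace 𝒯 u₀, trace 𝒯 M₀) v := by
    intro v
    rw [← hq, ← bForm_eq, ← hR, inner_embed]
    rfl
  -- Testing with (z, 0): M - R₁'' has second derivative R₁ and the trace M̂.
  obtain ⟨m, hm, hm2, hmt⟩ := exists_H2_of_broken_weak (𝒯 := 𝒯) (x.2.1 - secondDeriv R.1)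
    (toL2 R.1) M₀ (by
      intro z
      have := key (z, BrokenH2.zero 𝒯)
      rw [pairing_trace] at this
      simp only [toL2_zero, secondDeriv_zero, inner_zero_right] at this
      rw [inner_sub_left]
      linarith)
  -- Testing with (0, W): u - t²M - R₂'' has second derivative R₂ - M and the trace û - t²M̂.
  obtain ⟨p, hp, hp2, hpt⟩ := exists_H2_of_broken_weak (𝒯 := 𝒯)
    (x.1 - t ^ 2 • x.2.1 - secondDeriv R.2) (toL2 R.2 - x.2.1)
    (H2.lin zero_lt_one u₀ M₀ (-t ^ 2)) (by
      intro z
      have := key (BrokenH2.zero 𝒯, z)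
      rw [pairing_trace] at this
      simp only [toL2_zero, secondDeriv_zero, inner_zero_right] at this
      simp only [inner_sub_left, inner_smul_left, H2.toL2_lin, H2.secondDeriv_lin, inner_add_left,
        conj_trivial]
      linarith)
  have hut : trace 𝒯 (H2.lin zero_lt_one p m (t ^ 2)) = trace 𝒯 u₀ := by
    rw [trace_lin, hpt, trace_lin, hmt]
    module
  have hBC' := hBC.congr (𝒯.endpoints_eq hut) (𝒯.endpoints_eq hmt)
  have hM : x.2.1 = m.toL2 + secondDeriv R.1 := by rw [hm]; abel
  have hu : x.1 = p.toL2 + t ^ 2 • x.2.1 + secondDeriv R.2 := by rw [hp]; abel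
  have hF : p.secondDeriv + m.toL2 = toL2 R.2 - secondDeriv R.1 := by rw [hp2, hm]; abel
  -- The datum R₂ - R₁'' is a difference of two components, hence s = 2η. The resulting bounds 108η,
  -- 17η and 200η on u, M and q̂ add up to 325η.
  obtain ⟨s1, s2, s3⟩ := hBC'.norm_le ht (s := 2 * η) (by rw [hm2]; linarith)
    (by rw [hF]; exact (norm_sub_le _ _).trans (by linarith))
  have hm2' : ‖m.secondDeriv‖ ≤ η := by rw [hm2]; exact n1
  have hsm : ∀ y : L2I, ‖t ^ 2 • y‖ ≤ ‖y‖ := fun y => by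
    rw [norm_smul, Real.norm_of_nonneg (sq_nonneg t)]
    exact mul_le_of_le_one_left (norm_nonneg _) (pow_le_one₀ ht.1 ht.2)
  have bM : ‖x.2.1‖ ≤ 17 * η := by
    rw [hM]; exact (norm_add_le _ _).trans (by linarith)
  have bu : ‖x.1‖ ≤ 108 * η := by
    rw [hu]
    have := norm_add_le (p.toL2 + t ^ 2 • x.2.1) (secondDeriv R.2)
    have := norm_add_le p.toL2 (t ^ 2 • x.2.1)
    have := hsm x.2.1
    linarith
  have bq : traceNorm 𝒯 x.2.2 ≤ 200 * η := by
    have h1 := traceNorm_trace_sq_le (𝒯 := 𝒯) (H2.lin zero_lt_one p m (t ^ 2)) m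
    rw [hut, hmt, ← hq, H2.toL2_lin, H2.secondDeriv_lin] at h1
    have k1 : ‖p.toL2 + t ^ 2 • m.toL2‖ ≤ 106 * η :=
      (norm_add_le _ _).trans (by linarith [hsm m.toL2])
    have k2 : ‖p.secondDeriv + t ^ 2 • m.secondDeriv‖ ≤ 20 * η :=
      (norm_add_le _ _).trans (by linarith [hsm m.secondDeriv])
    have k3 := pow_le_pow_left₀ (norm_nonneg _) k1 2
    have k4 := pow_le_pow_left₀ (norm_nonneg _) k2 2
    have k5 := pow_le_pow_left₀ (norm_nonneg _) s1 2
    have k6 := pow_le_pow_left₀ (norm_nonneg _) hm2' 2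
    refine (abs_le_of_sq_le_sq' ?_ (by positivity)).2
    nlinarith [sq_nonneg η]
  unfold trialNorm
  linarith

theorem cubic_secondDeriv_add (c₀ c₁ c₂ c₃ : ℝ) :
    (H2.cubic zero_le_one c₂ c₃ (-c₀ / 2) (-c₁ / 6)).secondDeriv
      + (H2.cubic zero_le_one c₀ c₁ 0 0).toL2 = 0 := by
  rw [H2.secondDeriv, H2.toL2, ← MemLp.toLp_add, Lp.eq_zero_iff_ae_eq_zero]
  refine (MemLp.coeFn_toLp _).trans (ae_of_all _ fun x => ?_)
  simp [H2.cubic, H2.ofPrimitive]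
  ring

theorem affine_secondDeriv (c₀ c₁ : ℝ) :
    (H2.cubic zero_le_one c₀ c₁ 0 0).secondDeriv = 0 := by
  rw [H2.secondDeriv, Lp.eq_zero_iff_ae_eq_zero]
  refine (MemLp.coeFn_toLp _).trans (ae_of_all _ fun x => ?_)
  simp [H2.cubic, H2.ofPrimitive]

/-- In the unknowns m = M and p = u - t²M the equations decouple into m'' = -f and p'' = -m. Two
double integrations and a homogeneous correction solve them with the boundary conditions; Green's
formula then gives the ultraweak form. -/
theorem exists_isSolution (𝒯 : Mesh n) (a : BC) (t : ℝ) (f : L2I) :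
    ∃ x, IsSolution 𝒯 a t f x := by
  let m₀ := H2.ofSecondDeriv zero_le_one 0 0 (fun x => -f x) (Lp.memLp f).neg
  let p₀ := H2.ofSecondDeriv zero_le_one 0 0 (fun x => -m₀.val x) m₀.sqInt_val.neg
  have hm₀ : m₀.secondDeriv = -f := by
    have : m₀.secondDeriv = -(Lp.memLp f).toLp := MemLp.toLp_neg (Lp.memLp f)
    rw [this, Lp.toLp_coeFn]
  have hp₀ : p₀.secondDeriv = -m₀.toL2 := MemLp.toLp_neg m₀.sqInt_val
  obtain ⟨c₀, c₁, c₂, c₃, h⟩ := exists_homogeneous_satisfiesBC a t m₀ p₀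
  set m := H2.lin zero_lt_one m₀ (H2.cubic zero_le_one c₀ c₁ 0 0) 1 with hm
  set p := H2.lin zero_lt_one p₀ (H2.cubic zero_le_one c₂ c₃ (-c₀ / 2) (-c₁ / 6)) 1 with hp
  set u := H2.lin zero_lt_one p m (t ^ 2) with hu
  have hm2 : m.secondDeriv = -f := by
    rw [hm, H2.secondDeriv_lin, affine_secondDeriv, hm₀]; simp
  have hp2 : p.secondDeriv = -m.toL2 := by
    rw [hp, hm, H2.secondDeriv_lin, H2.toL2_lin, hp₀,
      eq_neg_of_add_eq_zero_left (cubic_secondDeriv_add c₀ c₁ c₂ c₃)]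
    module
  refine ⟨(u.toL2, m.toL2, (trace 𝒯 u, trace 𝒯 m)), ⟨u, m, h, rfl⟩, fun v => ?_⟩
  rw [bForm_eq, load_eq, pairing_trace]
  simp only [hu, H2.secondDeriv_lin, H2.toL2_lin, hm2, hp2, inner_add_left, inner_smul_left,
    inner_neg_left, conj_trivial]
  ring

/-- The trial-to-test operator exists. -/
theorem exists_trialToTest (𝒯 : Mesh n) {t : ℝ} (ht : t ∈ Icc (0 : ℝ) 1) :
    ∃ T : Triple n → TestSpace 𝒯, ∀ x v,
      inner ℝ (embed (T x)) (embed v) = bForm 𝒯 t x v := by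
  have : ∀ x : Triple n, ∃ R : TestSpace 𝒯, ∀ v, inner ℝ (embed R) (embed v) = bForm 𝒯 t x v := by
    intro x
    obtain ⟨e, _, he⟩ := exists_bForm_eq_inner (𝒯 := 𝒯) t ht x
    obtain ⟨R, hR⟩ := exists_embed_inner_eq 𝒯 e
    exact ⟨R, fun v => by rw [hR, he]⟩
  choose T hT using this
  exact ⟨T, hT⟩

theorem embed_lin (v w : TestSpace 𝒯) (c : ℝ) :
    embed ((BrokenH2.lin v.1 w.1 c, BrokenH2.lin v.2 w.2 c) : TestSpace 𝒯)
      = embed v + c • embed w := by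
  ext1 i
  fin_cases i
  · exact toL2_lin v.1 w.1 c
  · exact secondDeriv_lin v.1 w.1 c
  · exact toL2_lin v.2 w.2 c
  · exact secondDeriv_lin v.2 w.2 c

/-- The difference of two embedded test functions is the embedding of a linear combination and may
itself be tested. Equality is available only after embedding, since elements of `H2` carry
representatives. -/
theorem eq_embed_of_inner_eq {R S : TestSpace 𝒯}
    (h : ∀ v : TestSpace 𝒯, inner ℝ (embed R) (embed v) = inner ℝ (embed S) (embed v)) :
    embed R = embed S := by
  have h1 := embed_lin R S (-1)
  have h2 : inner ℝ (embed R - embed S) (embed R - embed S) = (0 : ℝ) := by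
    have : embed R - embed S = embed R + (-1 : ℝ) • embed S := by module
    rw [this, ← h1, h1, inner_add_left, ← h1, inner_smul_left, h, conj_trivial]
    ring
  exact sub_eq_zero.1 (inner_self_eq_zero.1 h2)

/-- The trial-to-test operator, followed by the embedding of the test space, as a linear map. -/
theorem exists_linear_trialToTest (𝒯 : Mesh n) {t : ℝ} (ht : t ∈ Icc (0 : ℝ) 1) :
    ∃ (T : Triple n → TestSpace 𝒯) (A : Triple n →ₗ[ℝ] TestHilbert), (∀ x, embed (T x) = A x) ∧
      (∀ x v, inner ℝ (A x) (embed v) = bForm 𝒯 t x v) ∧ ∀ x, ‖A x‖ ≤ 4 * trialNorm 𝒯 x := by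
  obtain ⟨T, hT⟩ := exists_trialToTest 𝒯 ht
  have hlin : ∀ (x y : Triple n) (c : ℝ),
      embed (T (x + c • y)) = embed (T x) + c • embed (T y) := by
    intro x y c
    rw [← embed_lin]
    refine eq_embed_of_inner_eq fun v => ?_
    rw [embed_lin, inner_add_left, inner_smul_left, conj_trivial, hT, hT, hT, bForm_lin]
  have h0 : embed (T 0) = 0 := by
    have := hlin 0 0 1
    rw [one_smul, one_smul, add_zero] at this
    simpa using this
  let A : Triple n →ₗ[ℝ] TestHilbert :=
    { toFun := fun x => embed (T x)
      map_add' := fun x y => by simpa using hlin x y 1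
      map_smul' := fun c x => by simpa [h0] using hlin 0 x c }
  refine ⟨T, A, fun _ => rfl, hT, fun x => ?_⟩
  obtain ⟨e, he, he'⟩ := exists_bForm_eq_inner (𝒯 := 𝒯) t ht x
  -- Testing with the representative `T x` itself transfers the continuity bound from `e` to `A x`.
  have h1 : ‖A x‖ ^ 2 ≤ ‖e‖ * ‖A x‖ := by
    rw [← real_inner_self_eq_norm_sq]
    have : inner ℝ (A x) (A x) = inner ℝ e (A x) := (hT x (T x)).trans (he' (T x))
    rw [this]
    exact real_inner_le_norm _ _
  have h2 : ‖A x‖ ≤ ‖e‖ := by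
    by_contra hc
    push Not at hc
    nlinarith [norm_nonneg e]
  exact h2.trans he

/-- The Galerkin projection exists and is a best approximation. -/
theorem exists_galerkin {X E : Type*} [AddCommGroup X] [Module ℝ X] [NormedAddCommGroup E]
    [InnerProductSpace ℝ E] (A : X →ₗ[ℝ] E) (U : Submodule ℝ X) [FiniteDimensional ℝ U] (F : E) :
    ∃ y ∈ U, ∀ δ ∈ U, inner ℝ (A y) (A δ) = inner ℝ F (A δ) := by
  obtain ⟨P, hP, hPe⟩ :=
    Submodule.HasOrthogonalProjection.exists_orthogonal (K := U.map A) F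
  obtain ⟨y, hy, rfl⟩ := hP
  refine ⟨y, hy, fun δ hδ => ?_⟩
  have := hPe (A δ) (Submodule.mem_map_of_mem hδ)
  rw [inner_sub_right, sub_eq_zero, real_inner_comm, real_inner_comm (A y)] at this
  exact this.symm

/-- Pythagoras: F - w is the sum of the orthogonal vectors F - y and y - w. -/
theorem norm_sub_le_of_galerkin {E : Type*} [NormedAddCommGroup E] [InnerProductSpace ℝ E]
    {F y w : E} (h : inner ℝ y (y - w) = inner ℝ F (y - w)) : ‖F - y‖ ≤ ‖F - w‖ := by
  have h1 : inner ℝ (F - y) (y - w) = (0 : ℝ) := by rw [inner_sub_left, h, sub_self]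
  have h2 : F - w = (F - y) + (y - w) := by abel
  have h3 := norm_add_sq_real (F - y) (y - w)
  rw [← h2, h1] at h3
  exact (abs_le_of_sq_le_sq' (by nlinarith [sq_nonneg ‖y - w‖]) (norm_nonneg _)).2

end

end Beam

end

/-! ### Well-posedness and quasi-optimality of the scheme -/

theorem theorem2 (a : Beam.BC) :
    ∃ C : ℝ, 0 < C ∧
      ∀ (t : ℝ), t ∈ Set.Icc (0 : ℝ) 1 →
      ∀ (f : Beam.L2I) (n : ℕ) (𝒯 : Beam.Mesh n),
        (∃! x : Beam.Triple n, Beam.IsSolution 𝒯 a t f x) ∧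
        ∀ x : Beam.Triple n, Beam.IsSolution 𝒯 a t f x →
        ∀ Uh : Submodule ℝ (Beam.Triple n), FiniteDimensional ℝ Uh →
          (Uh : Set (Beam.Triple n)) ⊆ Beam.trialSpace 𝒯 a t →
          (∃! y : Beam.Triple n, Beam.IsDPGSolution 𝒯 a t f Uh y) ∧
          ∀ y : Beam.Triple n, Beam.IsDPGSolution 𝒯 a t f Uh y →
            Beam.fullError 𝒯 x y ≤ C * (⨅ w : Uh, Beam.fullError 𝒯 x w) ∧
            ((∀ r ∈ Beam.traceSpace 𝒯 a t, ((0, 0, r) : Beam.Triple n) ∈ Uh) →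
              Beam.fullError 𝒯 x y ≤ C * (⨅ w : Uh, Beam.l2Error x (w : Beam.Triple n))) := by
  -- 1300 = 325 · 4, the inf-sup constant times the continuity constant.
  refine ⟨1300, by norm_num, fun t ht f n 𝒯 => ?_⟩
  obtain ⟨T, A, hTA, hA, hA4⟩ := Beam.exists_linear_trialToTest 𝒯 ht
  have hinf : ∀ x ∈ Beam.trialSpace 𝒯 a t, Beam.trialNorm 𝒯 x ≤ 325 * ‖A x‖ := by
    intro x hx
    have := Beam.trialNorm_le_norm_embed ht hx (R := T x) fun v => by rw [hTA, hA]
    rwa [hTA] at this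
  have hinj : ∀ x ∈ Beam.trialSpace 𝒯 a t, ∀ y ∈ Beam.trialSpace 𝒯 a t, A x = A y → x = y := by
    intro x hx y hy h
    have h1 := hinf _ (Beam.trialSpace_sub hx hy)
    rw [map_sub, h, sub_self, norm_zero, mul_zero] at h1
    exact sub_eq_zero.1 (Beam.eq_zero_of_trialNorm_nonpos h1)
  have heq : ∀ x y : Beam.Triple n, (∀ v, Beam.bForm 𝒯 t x v = Beam.bForm 𝒯 t y v) → A x = A y := by
    intro x y h
    rw [← hTA, ← hTA]
    refine Beam.eq_embed_of_inner_eq fun v => ?_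
    rw [hTA, hTA, hA, hA, h]
  refine ⟨?_, fun x hx Uh hUh hsub => ?_⟩
  · obtain ⟨x, hx⟩ := Beam.exists_isSolution 𝒯 a t f
    exact ⟨x, hx, fun y hy => hinj _ hy.1 _ hx.1 (heq _ _ fun v => by rw [hx.2, hy.2])⟩
  -- The scheme allows any trial-to-test operator; on the discrete space they all have the same
  -- embedding, so the choice is immaterial.
  have hT : ∀ S : Beam.Triple n → Beam.TestSpace 𝒯, Beam.IsTrialToTest 𝒯 a t S →
      ∀ δ ∈ Uh, Beam.embed (S δ) = A δ := by
    intro S hS δ hδ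
    rw [← hTA]
    refine Beam.eq_embed_of_inner_eq fun v => ?_
    rw [← Beam.testInner_eq, hS δ (hsub hδ), hTA, hA]
  -- The load is b_t(x, ·), so the DPG equations are the normal equations of the least-squares
  -- problem for A.
  have hdpg : ∀ y, Beam.IsDPGSolution 𝒯 a t f Uh y ↔
      y ∈ Uh ∧ ∀ δ ∈ Uh, inner ℝ (A y) (A δ) = inner ℝ (A x) (A δ) := by
    refine fun y => and_congr_right fun hy => ⟨?_, fun h => ?_⟩
    · rintro ⟨S, hS, h⟩ δ hδ
      rw [← hT S hS δ hδ, hA, hA, hx.2, h δ hδ]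
    · refine ⟨T, fun z _ v => by rw [Beam.testInner_eq, hTA, hA], fun δ hδ => ?_⟩
      rw [← hx.2, ← hA, ← hA, hTA, h δ hδ]
  refine ⟨?_, fun y hy => ?_⟩
  · obtain ⟨y, hyU, hy⟩ := Beam.exists_galerkin A Uh (A x)
    refine ⟨y, (hdpg y).2 ⟨hyU, hy⟩, fun y' hy' => ?_⟩
    obtain ⟨hyU', hy'⟩ := (hdpg y').1 hy'
    refine hinj _ (hsub hyU') _ (hsub hyU) (sub_eq_zero.1 ?_)
    rw [← map_sub, ← inner_self_eq_zero (𝕜 := ℝ)]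
    have hd : y' - y ∈ Uh := Uh.sub_mem hyU' hyU
    nth_rewrite 1 [map_sub]
    rw [inner_sub_left, hy' _ hd, hy _ hd, sub_self]
  obtain ⟨hyU, hy⟩ := (hdpg y).1 hy
  have hbest : ∀ w ∈ Uh, Beam.fullError 𝒯 x y ≤ 1300 * Beam.fullError 𝒯 x w := by
    intro w hw
    have h1 := hinf _ (Beam.trialSpace_sub hx.1 (hsub hyU))
    have h2 := hA4 (x - w)
    rw [map_sub] at h1 h2
    have h3 := hy _ (Uh.sub_mem hyU hw)
    rw [map_sub] at h3
    have h4 := Beam.norm_sub_le_of_galerkin h3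
    change Beam.trialNorm 𝒯 (x - y) ≤ 1300 * Beam.trialNorm 𝒯 (x - w)
    linarith
  have hC : (0 : ℝ) ≤ 1300 := by norm_num
  refine ⟨?_, fun hr => ?_⟩
  · rw [Real.mul_iInf_of_nonneg hC]
    exact le_ciInf fun w => hbest w w.2
  · rw [Real.mul_iInf_of_nonneg hC]
    refine le_ciInf fun w => ?_
    have hq : x.2.2 - (w : Beam.Triple n).2.2 ∈ Beam.traceSpace 𝒯 a t := by
      have := Beam.trialSpace_sub hx.1 (hsub w.2)
      exact this
    -- Adding (0, 0, q̂ - r̂) to the competitor gives it the exact trace while leaving its L₂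
    -- components unchanged, so only the L₂ error remains.
    have h1 := hbest _ (Uh.add_mem w.2 (hr _ hq))
    refine h1.trans_eq ?_
    have h2 : Beam.traceNorm 𝒯 (0 : Beam.TraceData n × Beam.TraceData n) = 0 := by
      simp [Beam.traceNorm, Beam.elemNormSq]
    simp [Beam.fullError, Beam.l2Error, h2]
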